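/- Let $P\subseteq[0,1]$ be a $\Pi^0_1$ class, that is, a subset of $[0,1]$ whose complement in $[0,1]$ is the intersection of $[0,1]$ with the union of a computably enumerable set of open intervals with rational endpoints. Let $X\in P$ be Martin-Löf random: a real $X \in [0,1]$ is Martin-Löf random if $X\notin\bigcap_n U_n$ for every sequence $(U_n)_{n\in\mathbb N}$ of uniformly effectively open subsets of $[0,1]$ (the sets $U_n$ are intersections of $[0,1]$ with unions of open rational intervals that are computably enumerable uniformly in $n$) such that each $U_n$ has Lebesgue measure at most $2^{-n}$. Let $k\in\mathbb N$. Then the following hold. (1) There is a rational number $q\neq 0$ such that $X+qi\in P$ for all integers $i$ with $0\le i\leq k$. (2) For every computable irrational number $\alpha$ there is an integer $n\neq 0$ such that $(X+\alpha n i \bmod 1)\in P$ for all integers $i$ with $0\le i\leq k$, where $y \bmod 1$ denotes the fractional part of $y$ in $[0,1)$. -/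

import Mathlib

open MeasureTheory Set
open scoped ENNReal

/-- The open interval with rational endpoints `a / (d + 1)` and `b / (d + 1)` coded by the triple
`(a, b, d)`. Every open interval with rational endpoints has such a code. -/
def ratInterval (c : ℤ × ℤ × ℕ) : Set ℝ :=
  Ioo ((c.1 : ℝ) / ((c.2.2 : ℝ) + 1)) ((c.2.1 : ℝ) / ((c.2.2 : ℝ) + 1))

/-- `U` is an effectively open (`Σ⁰₁`) subset of the unit interval: the part in `[0,1]` of the
union of a computably enumerable set of open intervals with rational endpoints. -/
def IsSigma01 (U : Set ℝ) : Prop :=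
  ∃ W : ℤ × ℤ × ℕ → Prop, REPred W ∧ U = Icc 0 1 ∩ ⋃ c, ⋃ (_ : W c), ratInterval c

/-- `P` is a `Π⁰₁` class in the unit interval: a subset of `[0,1]` whose complement in `[0,1]` is
effectively open. -/
def IsPi01Class (P : Set ℝ) : Prop :=
  P ⊆ Icc 0 1 ∧ IsSigma01 (Icc 0 1 \ P)

/-- `U 0, U 1, …` are uniformly effectively open subsets of the unit interval. -/
def IsUniformlySigma01 (U : ℕ → Set ℝ) : Prop :=
  ∃ W : ℕ × (ℤ × ℤ × ℕ) → Prop, REPred W ∧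
    ∀ n, U n = Icc 0 1 ∩ ⋃ c, ⋃ (_ : W (n, c)), ratInterval c

/-- A Martin-Löf test on the unit interval with Lebesgue measure. -/
def IsMartinLofTest (U : ℕ → Set ℝ) : Prop :=
  IsUniformlySigma01 U ∧ ∀ n, volume (U n) ≤ (2 : ℝ≥0∞)⁻¹ ^ n

/-- A real in `[0,1]` is Martin-Löf random if it passes every Martin-Löf test. -/
def IsMartinLofRandom (x : ℝ) : Prop :=
  x ∈ Icc (0 : ℝ) 1 ∧ ∀ U : ℕ → Set ℝ, IsMartinLofTest U → x ∉ ⋂ n, U n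

/-- A real number is computable if some computable sequence of integers `f` gives rational
approximations `f n / 2 ^ n` that are correct up to `2 ^ (-n)`. -/
def IsComputableReal (x : ℝ) : Prop :=
  ∃ f : ℕ → ℤ, Computable f ∧ ∀ n, |x - (f n : ℝ) / 2 ^ n| ≤ 1 / 2 ^ n

/-!
Write `B` for the open set of the intervals that enumerate the complement of `P`, so that
`P = [0,1] \ B`. Both parts follow from one recurrence statement,
`IsMartinLofRandom.exists_progression`: if `t` is a dense family of reals whose lower and upper cuts
are recursively enumerable, then for some index `h` with `t h ≠ 0` all the points `X + t h * i`,
`i ≤ k`, are in `P`. Part (1) takes for `t` all rationals. Part (2) takes the numbers `u * α + v`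
with integers `u` and `v`, which are dense because `α` is irrational; as the progression stays
in `[0,1)`, reducing `X + α * u * i` modulo `1` gives `X + (u * α + v) * i`.

The tests are built by promotion. A computable rule promotes, inside each dyadic cell, smaller
dyadic cells that together fill at most a fraction `c < 1` of it. Iterating the rule, the points
that are promoted `m` times have measure at most `c ^ m`, and along a subsequence of the `m` they
form a Martin-Löf test. Hence a random `X` lies in some cell in which no smaller cell around `X`
is promoted (`IsMartinLofRandom.exists_no_promotion`). This is used twice.

* Density (`IsMartinLofRandom.exists_small_density`). Suppose that `B` fills more than a fraction
  `1 / K` of every cell around `X`. Inside a cell, wait for the stage at which this is visible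
  and promote the cells not yet in `B`. Since `X` is not in `B`, it is promoted for ever. So for
  each `K` there is a cell `J` around `X` of which `B` fills at most a fraction `1 / K`.
* Recurrence (`IsMartinLofRandom.exists_progression_of_small_measure`). Let `I` be a cell of length
  `2 ^ (-b)` in the half of `J` that contains `X`. Choose computably a number of steps `t_j`
  proportional to `2 ^ b * |J|`, with distances at least `|I|`, pointing towards the other half of
  `J` and so short that `I + t_j * i` stays in `J` for `i ≤ k`. Promote the cells of those points
  `x` for which *every* step `t_j` has some `x + t_j * i` in `B`, `1 ≤ i ≤ k`. For fixed `i` the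
  translates of `I` by `t_j * i` are disjoint subsets of `J`. Counting each promoted point once for
  each `j` therefore bounds the promoted measure by `k * |B ∩ J|` divided by the number of steps
  (`card_mul_volume_progression_le`), which is at most half of `|I|` if `K` is large. The choice of
  the steps does not depend on how `B` is enumerated, so the rule is a legitimate one. In a cell in
  which `X` is not promoted, one of the steps works.
-/

/-! ### Primitive recursive integer arithmetic -/

/-- The encoding of `ℤ` sends `n` to `2 * n` and `-(n + 1)` to `2 * n + 1`. -/
theorem Primrec.int_toNat : Primrec Int.toNat := by
  have h : Primrec fun z : ℤ =>
      if Encodable.encode z % 2 = 0 then Encodable.encode z / 2 else 0 :=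
    Primrec.ite (Primrec.eq.comp (Primrec.nat_mod.comp Primrec.encode (Primrec.const 2))
      (Primrec.const 0)) (Primrec.nat_div.comp Primrec.encode (Primrec.const 2)) (Primrec.const 0)
  refine h.of_eq fun z => ?_
  cases z with
  | ofNat n =>
    have : Encodable.encode (Int.ofNat n) = 2 * n := rfl
    rw [this]; simp
  | negSucc n =>
    have : Encodable.encode (Int.negSucc n) = 2 * n + 1 := rfl
    rw [this, if_neg (by omega)]; simp

theorem Primrec.int_natAbs : Primrec Int.natAbs := by
  have h : Primrec fun z : ℤ => (Encodable.encode z + 1) / 2 :=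
    Primrec.nat_div.comp (Primrec.nat_add.comp Primrec.encode (Primrec.const 1)) (Primrec.const 2)
  refine h.of_eq fun z => ?_
  cases z with
  | ofNat n =>
    have : Encodable.encode (Int.ofNat n) = 2 * n := rfl
    rw [this]; simp; omega
  | negSucc n =>
    have : Encodable.encode (Int.negSucc n) = 2 * n + 1 := rfl
    rw [this]; simp; omega

theorem Primrec.int_subNatNat : Primrec₂ fun a b : ℕ => (a : ℤ) - b := by
  refine Primrec.encode_iff.1 ?_
  have h : Primrec fun p : ℕ × ℕ =>
      if p.2 ≤ p.1 then 2 * (p.1 - p.2) else 2 * (p.2 - p.1) - 1 :=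
    Primrec.ite (Primrec.nat_le.comp Primrec.snd Primrec.fst)
      (Primrec.nat_mul.comp (Primrec.const 2) (Primrec.nat_sub.comp Primrec.fst Primrec.snd))
      (Primrec.nat_sub.comp (Primrec.nat_mul.comp (Primrec.const 2)
        (Primrec.nat_sub.comp Primrec.snd Primrec.fst)) (Primrec.const 1))
  refine h.of_eq fun ⟨a, b⟩ => ?_
  dsimp only
  split_ifs with hab
  · obtain ⟨c, rfl⟩ := Nat.exists_eq_add_of_le hab
    have : ((b + c : ℕ) : ℤ) - b = Int.ofNat c := by simp
    rw [this]
    have : Encodable.encode (Int.ofNat c) = 2 * c := rfl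
    omega
  · obtain ⟨c, rfl⟩ := Nat.exists_eq_add_of_lt (not_le.1 hab)
    have : (a : ℤ) - ((a + c + 1 : ℕ) : ℤ) = Int.negSucc c := by
      rw [Int.negSucc_eq]; push_cast; ring
    rw [this]
    have : Encodable.encode (Int.negSucc c) = 2 * c + 1 := rfl
    omega

theorem Primrec.int_natCast : Primrec (Nat.cast : ℕ → ℤ) :=
  (Primrec.int_subNatNat.comp Primrec.id (Primrec.const 0)).of_eq fun n => by simp

theorem Primrec.int_neg_toNat : Primrec fun z : ℤ => (-z).toNat :=
  (Primrec.nat_sub.comp Primrec.int_natAbs Primrec.int_toNat).of_eq fun z => by omega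

theorem Primrec.int_add : Primrec₂ ((· + ·) : ℤ → ℤ → ℤ) :=
  (Primrec.int_subNatNat.comp
    (Primrec.nat_add.comp (Primrec.int_toNat.comp Primrec.fst) (Primrec.int_toNat.comp Primrec.snd))
    (Primrec.nat_add.comp (Primrec.int_neg_toNat.comp Primrec.fst)
      (Primrec.int_neg_toNat.comp Primrec.snd))).of_eq fun p => by
    push_cast; omega

theorem Primrec.int_neg : Primrec (Neg.neg : ℤ → ℤ) :=
  (Primrec.int_subNatNat.comp Primrec.int_neg_toNat Primrec.int_toNat).of_eq fun p => by
    omega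

theorem Primrec.int_sub : Primrec₂ ((· - ·) : ℤ → ℤ → ℤ) :=
  (Primrec.int_add.comp Primrec.fst (Primrec.int_neg.comp Primrec.snd)).of_eq fun p => by
    simp [sub_eq_add_neg]

theorem Primrec.int_mul : Primrec₂ ((· * ·) : ℤ → ℤ → ℤ) :=
  (Primrec.int_subNatNat.comp
    (Primrec.nat_add.comp
      (Primrec.nat_mul.comp (Primrec.int_toNat.comp Primrec.fst)
        (Primrec.int_toNat.comp Primrec.snd))
      (Primrec.nat_mul.comp (Primrec.int_neg_toNat.comp Primrec.fst)
        (Primrec.int_neg_toNat.comp Primrec.snd)))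
    (Primrec.nat_add.comp
      (Primrec.nat_mul.comp (Primrec.int_toNat.comp Primrec.fst)
        (Primrec.int_neg_toNat.comp Primrec.snd))
      (Primrec.nat_mul.comp (Primrec.int_neg_toNat.comp Primrec.fst)
        (Primrec.int_toNat.comp Primrec.snd)))).of_eq fun ⟨x, y⟩ => by
    obtain ⟨a, rfl | rfl⟩ := x.eq_nat_or_neg <;> obtain ⟨b, rfl | rfl⟩ := y.eq_nat_or_neg <;>
      simp

theorem Primrec.int_lt : PrimrecRel ((· < ·) : ℤ → ℤ → Prop) :=
  (Primrec.nat_lt.comp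
    (Primrec.nat_add.comp (Primrec.int_toNat.comp Primrec.fst)
      (Primrec.int_neg_toNat.comp Primrec.snd))
    (Primrec.nat_add.comp (Primrec.int_toNat.comp Primrec.snd)
      (Primrec.int_neg_toNat.comp Primrec.fst))).of_eq fun p => by
    show _ ↔ p.1 < p.2
    omega

theorem Primrec.nat_pow : Primrec₂ ((· ^ ·) : ℕ → ℕ → ℕ) :=
  Primrec₂.unpaired'.1 Nat.Primrec.pow

/-! ### Recursively enumerable predicates -/

theorem PrimrecPred.to_re {α : Type*} [Primcodable α] {p : α → Prop} (hp : PrimrecPred p) :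
    REPred p :=
  hp.computablePred.to_re

namespace REPred

variable {α β : Type*} [Primcodable α] [Primcodable β]

theorem comp {p : β → Prop} (hp : REPred p) {g : α → β} (hg : Computable g) :
    REPred fun a => p (g a) :=
  Partrec.comp hp hg

protected theorem and {p q : α → Prop} (hp : REPred p) (hq : REPred q) :
    REPred fun a => p a ∧ q a := by
  have := (Partrec.bind hp (Partrec.comp hq (Computable.fst (β := Unit))).to₂).dom_re
  exact this.of_eq fun a => by simp [Part.assert]

/-- A recursively enumerable predicate is enumerated in stages by a computable test. -/
theorem exists_stage {p : α → Prop} (hp : REPred p) :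
    ∃ f : α → ℕ → Bool, Computable₂ f ∧ ∀ a, p a ↔ ∃ n, f a n = true := by
  obtain ⟨c, hc⟩ := Nat.Partrec.Code.exists_code.1 hp
  refine ⟨fun a n => (Nat.Partrec.Code.evaln n c (Encodable.encode a)).isSome, ?_, fun a => ?_⟩
  · exact (Primrec.option_isSome.comp (Nat.Partrec.Code.primrec_evaln.comp
      (((Primrec.snd).pair (Primrec.const c)).pair (Primrec.encode.comp Primrec.fst)))).to_comp
  · have h : p a ↔ (Nat.Partrec.Code.eval c (Encodable.encode a)).Dom := by
      rw [hc]; simp [Part.assert]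
    rw [h, Part.dom_iff_mem]
    simp only [Nat.Partrec.Code.evaln_complete, Option.isSome_iff_exists, Option.mem_def]
    exact exists_comm

theorem of_stage {f : α → ℕ → Bool} (hf : Computable₂ f) : REPred fun a => ∃ n, f a n = true := by
  have : Partrec fun a => Nat.rfind fun n => Part.some (f a n) := Partrec.rfind hf.partrec₂
  refine this.dom_re.of_eq fun a => ?_
  refine Nat.rfind_dom.trans ⟨fun ⟨n, hn, _⟩ => ⟨n, (Part.mem_some_iff.1 hn).symm⟩, ?_⟩
  rintro ⟨n, hn⟩
  exact ⟨n, Part.mem_some_iff.2 hn.symm, fun _ => trivial⟩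

theorem exists_right {p : α → β → Prop} (hp : REPred fun x : α × β => p x.1 x.2) :
    REPred fun a => ∃ b, p a b := by
  obtain ⟨f, hf, h⟩ := hp.exists_stage
  have hg : Computable₂ fun (a : α) (n : ℕ) =>
      Option.casesOn (motive := fun _ => Bool) (Encodable.decode (α := β) n.unpair.1) false
        fun b => f (a, b) n.unpair.2 := by
    refine Computable.option_casesOn
      (Computable.decode.comp (Computable.fst.comp (Computable.unpair.comp Computable.snd)))
      (Computable.const false) ?_
    exact hf.comp ((Computable.fst.comp Computable.fst).pair Computable.snd)
      (Computable.snd.comp (Computable.unpair.comp (Computable.snd.comp Computable.fst)))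
  refine (of_stage hg).of_eq fun a => ⟨?_, ?_⟩
  · rintro ⟨n, hn⟩
    cases hd : Encodable.decode (α := β) n.unpair.1 with
    | none => simp [hd] at hn
    | some b => exact ⟨b, (h (a, b)).2 ⟨_, by simpa [hd] using hn⟩⟩
  · rintro ⟨b, hb⟩
    obtain ⟨s, hs⟩ := (h (a, b)).1 hb
    exact ⟨Nat.pair (Encodable.encode b) s, by simpa using hs⟩

theorem forall_lt {p : α → ℕ → Prop} (hp : REPred fun x : α × ℕ => p x.1 x.2) {g : α → ℕ}
    (hg : Computable g) : REPred fun a => ∀ j < g a, p a j := by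
  have h : Partrec fun a => (Nat.rec (Part.some ()) (fun j (ih : Part Unit) => ih.bind fun _ =>
      Part.assert (p a j) fun _ => Part.some ()) (g a) : Part Unit) :=
    Partrec.nat_rec hg (Partrec.const' _) (Partrec.comp hp
      (Computable.fst.pair (Computable.fst.comp Computable.snd))).to₂
  refine h.dom_re.of_eq fun a => ?_
  induction g a with
  | zero => simp
  | succ n ih =>
    simp only [Part.bind_dom, ih, Nat.lt_succ_iff_lt_or_eq, or_imp, forall_and, forall_eq]
    simp [Part.assert]

/-- A recursively enumerable relation that is total has a computable choice function. -/
theorem exists_uniformization {p : α → β → Prop} (hp : REPred fun x : α × β => p x.1 x.2)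
    (h : ∀ a, ∃ b, p a b) : ∃ g : α → β, Computable g ∧ ∀ a, p a (g a) := by
  obtain ⟨f, hf, hfp⟩ := hp.exists_stage
  have hg : Computable₂ fun (a : α) (n : ℕ) =>
      Option.casesOn (motive := fun _ => Option β) (Encodable.decode (α := β) n.unpair.1) none
        fun b => cond (f (a, b) n.unpair.2) (some b) none := by
    refine Computable.option_casesOn
      (Computable.decode.comp (Computable.fst.comp (Computable.unpair.comp Computable.snd)))
      (Computable.const none) ?_
    exact Computable.cond (hf.comp ((Computable.fst.comp Computable.fst).pair Computable.snd)
      (Computable.snd.comp (Computable.unpair.comp (Computable.snd.comp Computable.fst))))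
      (Computable.option_some.comp Computable.snd) (Computable.const none)
  have hr := Partrec.rfindOpt hg
  have key : ∀ a n b, (Option.casesOn (motive := fun _ => Option β)
      (Encodable.decode (α := β) (Nat.unpair n).1) none
        fun b => cond (f (a, b) (Nat.unpair n).2) (some b) none) = some b → p a b := by
    intro a n b hb
    cases hd : Encodable.decode (α := β) n.unpair.1 with
    | none => simp [hd] at hb
    | some b' =>
      cases hc : f (a, b') n.unpair.2 with
      | false => simp [hd, hc] at hb
      | true =>
        simp only [hd, hc, cond_true, Option.some.injEq] at hb
        exact hb ▸ (hfp (a, b')).2 ⟨_, hc⟩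
  have hdom : ∀ a, (Nat.rfindOpt fun n => (Option.casesOn (motive := fun _ => Option β)
      (Encodable.decode (α := β) (Nat.unpair n).1) none
        fun b => cond (f (a, b) (Nat.unpair n).2) (some b) none)).Dom := by
    intro a
    obtain ⟨b, hb⟩ := h a
    obtain ⟨s, hs⟩ := (hfp (a, b)).1 hb
    exact Nat.rfindOpt_dom.2 ⟨Nat.pair (Encodable.encode b) s, b, by simp [hs]⟩
  refine ⟨fun a => (Nat.rfindOpt _).get (hdom a), hr.of_eq_tot fun a => Part.get_mem _, fun a => ?_⟩
  obtain ⟨n, hn⟩ := Nat.rfindOpt_spec (Part.get_mem (hdom a))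
  exact key a n _ hn

theorem eq_of_computable [DecidableEq β] {f g : α → β} (hf : Computable f) (hg : Computable g) :
    REPred fun a => f a = g a :=
  (PrimrecPred.to_re Primrec.eq).comp (hf.pair hg)

theorem nat_le_of_computable {f g : α → ℕ} (hf : Computable f) (hg : Computable g) :
    REPred fun a => f a ≤ g a :=
  (PrimrecPred.to_re Primrec.nat_le).comp (hf.pair hg)

theorem int_lt_of_computable {f g : α → ℤ} (hf : Computable f) (hg : Computable g) :
    REPred fun a => f a < g a :=
  (PrimrecPred.to_re Primrec.int_lt).comp (hf.pair hg)

end REPred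

/-! ### Dyadic cells -/

/-- The half-open dyadic interval `[a / 2 ^ n, (a + 1) / 2 ^ n)`, the `a`-th cell of level `n`. -/
def dyadicCell (n a : ℕ) : Set ℝ := Ico ((a : ℝ) / 2 ^ n) (((a : ℝ) + 1) / 2 ^ n)

/-- The index of the cell of level `n` that contains the nonnegative real `x`. -/
noncomputable def cellIndex (n : ℕ) (x : ℝ) : ℕ := ⌊x * 2 ^ n⌋₊

theorem cellIndex_eq_iff {n a : ℕ} {x : ℝ} (hx : 0 ≤ x) :
    cellIndex n x = a ↔ x ∈ dyadicCell n a := by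
  have h2 : (0 : ℝ) < 2 ^ n := by positivity
  rw [cellIndex, Nat.floor_eq_iff (by positivity), dyadicCell, mem_Ico, div_le_iff₀ h2,
    lt_div_iff₀ h2]

theorem nonneg_of_mem_dyadicCell {n a : ℕ} {x : ℝ} (hx : x ∈ dyadicCell n a) : 0 ≤ x :=
  le_trans (by positivity) hx.1

theorem cellIndex_of_mem {n a : ℕ} {x : ℝ} (hx : x ∈ dyadicCell n a) : cellIndex n x = a :=
  (cellIndex_eq_iff (nonneg_of_mem_dyadicCell hx)).2 hx

theorem mem_dyadicCell_cellIndex {n : ℕ} {x : ℝ} (hx : 0 ≤ x) :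
    x ∈ dyadicCell n (cellIndex n x) :=
  (cellIndex_eq_iff hx).1 rfl

/-- The cell of level `b` above the cell `a` of level `n` has index `a / 2 ^ (n - b)`. -/
theorem cellIndex_div {b n : ℕ} (h : b ≤ n) (x : ℝ) :
    cellIndex n x / 2 ^ (n - b) = cellIndex b x := by
  rw [cellIndex, cellIndex, ← Nat.floor_div_natCast]
  congr 1
  obtain ⟨c, rfl⟩ := Nat.exists_eq_add_of_le h
  rw [Nat.add_sub_cancel_left]
  push_cast
  rw [pow_add]
  field_simp

theorem volume_dyadicCell (n a : ℕ) : volume (dyadicCell n a) = (2 : ℝ≥0∞)⁻¹ ^ n := by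
  rw [dyadicCell, Real.volume_Ico, ← sub_div, add_sub_cancel_left, one_div, ← inv_pow,
    ENNReal.ofReal_pow (by norm_num), ENNReal.ofReal_inv_of_pos (by norm_num)]
  simp

theorem measurableSet_dyadicCell (n a : ℕ) : MeasurableSet (dyadicCell n a) := measurableSet_Ico

/-! ### Randomness tests built by successive promotions -/

/-- One step of the promotion process: the state `s = (m, b)` records that `m` promotions took
place, the last one at level `b`. At level `n > b` the cell `a` is promoted if `chk n a b` holds. -/
def promotionStep (chk : ℕ → ℕ → ℕ → Bool) (s : ℕ × ℕ) (n a : ℕ) : ℕ × ℕ :=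
  if s.2 < n ∧ chk n a s.2 = true then (s.1 + 1, n) else s

/-- The state of the promotion process, started at level `b₀`, along the cells above the cell `a`
of level `n`. -/
def cellState (chk : ℕ → ℕ → ℕ → Bool) (b₀ n a : ℕ) : ℕ × ℕ :=
  Nat.rec (0, b₀) (fun l s => promotionStep chk s (l + 1) (a / 2 ^ (n - (l + 1)))) n

/-- The state of the promotion process along the cells of levels at most `n` containing `x`. -/
noncomputable def pointState (chk : ℕ → ℕ → ℕ → Bool) (b₀ : ℕ) (x : ℝ) (n : ℕ) : ℕ × ℕ :=
  Nat.rec (0, b₀) (fun l s => promotionStep chk s (l + 1) (cellIndex (l + 1) x)) n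

section Promotion

variable {chk : ℕ → ℕ → ℕ → Bool} {b₀ : ℕ} {x : ℝ}

theorem cellState_cellIndex (n : ℕ) :
    cellState chk b₀ n (cellIndex n x) = pointState chk b₀ x n := by
  have key : ∀ m ≤ n, (Nat.rec (0, b₀) (fun l s => promotionStep chk s (l + 1)
      (cellIndex n x / 2 ^ (n - (l + 1)))) m : ℕ × ℕ) = pointState chk b₀ x m := by
    intro m
    induction m with
    | zero => intro _; rfl
    | succ m ih =>
      intro hm
      have := ih (by omega)
      simp only [pointState] at this ⊢
      rw [this, cellIndex_div hm]
  exact key n le_rfl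

theorem computable_cellState
    (hchk : Computable fun q : ℕ × ℕ × ℕ => chk q.1 q.2.1 q.2.2) (b₀ : ℕ) :
    Computable₂ (cellState chk b₀) := by
  refine Computable.nat_rec (f := fun q : ℕ × ℕ => q.1) (g := fun _ => (0, b₀))
    (h := fun q s => promotionStep chk s.2 (s.1 + 1) (q.2 / 2 ^ (q.1 - (s.1 + 1))))
    Computable.fst (Computable.const _) ?_
  -- the step at level `q.2.1 + 1`, where `q.1 = (n, a)` and `q.2.2` is the state reached so far
  have hl : Computable fun q : (ℕ × ℕ) × ℕ × ℕ × ℕ => q.2.1 + 1 :=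
    Computable.succ.comp (Computable.fst.comp Computable.snd)
  have hs : Computable fun q : (ℕ × ℕ) × ℕ × ℕ × ℕ => q.2.2 := Computable.snd.comp Computable.snd
  have ha : Computable fun q : (ℕ × ℕ) × ℕ × ℕ × ℕ => q.1.2 / 2 ^ (q.1.1 - (q.2.1 + 1)) :=
    Primrec.nat_div.to_comp.comp (Computable.snd.comp Computable.fst)
      (Primrec.nat_pow.to_comp.comp (Computable.const 2)
        (Primrec.nat_sub.to_comp.comp (Computable.fst.comp Computable.fst) hl))
  have hc := hchk.comp (hl.pair (ha.pair (Computable.snd.comp hs)))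
  have hlt : Computable fun q : (ℕ × ℕ) × ℕ × ℕ × ℕ => decide (q.2.2.2 < q.2.1 + 1) :=
    Primrec.nat_lt.decide.to_comp.comp (Computable.snd.comp hs) hl
  refine (Computable.cond (Primrec.and.to_comp.comp hlt hc)
    ((Computable.succ.comp (Computable.fst.comp hs)).pair hl) hs).of_eq fun q => ?_
  simp only [promotionStep, Bool.cond_eq_ite, Bool.and_eq_true, decide_eq_true_eq,
    Nat.succ_eq_add_one]

theorem pointState_succ (n : ℕ) : pointState chk b₀ x (n + 1) =
    promotionStep chk (pointState chk b₀ x n) (n + 1) (cellIndex (n + 1) x) := rfl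

theorem pointState_of_le {n : ℕ} (hn : n ≤ b₀) : pointState chk b₀ x n = (0, b₀) := by
  induction n with
  | zero => rfl
  | succ n ih =>
    rw [pointState_succ, ih (by omega), promotionStep, if_neg]
    simp; omega

theorem le_pointState_snd (n : ℕ) : b₀ ≤ (pointState chk b₀ x n).2 := by
  induction n with
  | zero => exact le_rfl
  | succ n ih =>
    rw [pointState_succ, promotionStep]
    split_ifs with h
    · show b₀ ≤ n + 1
      omega
    · exact ih

theorem pointState_snd_le {n : ℕ} (hn : b₀ ≤ n) : (pointState chk b₀ x n).2 ≤ n := by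
  induction n, hn using Nat.le_induction with
  | base => rw [pointState_of_le le_rfl]
  | succ n hn ih =>
    rw [pointState_succ, promotionStep]
    split_ifs with h
    · exact le_rfl
    · omega

/-- The current state was entered at the level that it records. -/
theorem pointState_pointState_snd {n : ℕ} (hn : b₀ ≤ n) :
    pointState chk b₀ x (pointState chk b₀ x n).2 = pointState chk b₀ x n := by
  induction n, hn using Nat.le_induction with
  | base => simp [pointState_of_le]
  | succ n hn ih =>
    rw [pointState_succ, promotionStep]
    split_ifs with h
    · show pointState chk b₀ x (n + 1) = _
      rw [pointState_succ, promotionStep, if_pos h]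
    · exact ih

theorem pointState_eq_or_lt {n n' m : ℕ} (h : pointState chk b₀ x n = (m, n)) (hn : n ≤ n') :
    pointState chk b₀ x n' = (m, n) ∨ m < (pointState chk b₀ x n').1 := by
  induction n', hn using Nat.le_induction with
  | base => exact Or.inl h
  | succ n' hn ih =>
    rw [pointState_succ, promotionStep]
    split_ifs with hs
    · right
      rcases ih with ih | ih
      · rw [ih]; exact Nat.lt_succ_self m
      · exact ih.trans (Nat.lt_succ_self _)
    · exact ih

/-- Each number of promotions is attained at one level at most. -/
theorem level_unique {n n' m : ℕ} (h : pointState chk b₀ x n = (m, n))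
    (h' : pointState chk b₀ x n' = (m, n')) : n = n' := by
  wlog hn : n ≤ n' generalizing n n'
  · exact (this h' h (by omega)).symm
  rcases pointState_eq_or_lt h hn with h1 | h1
  · rw [h'] at h1
    exact (Prod.ext_iff.1 h1).2.symm
  · rw [h'] at h1
    exact absurd h1 (lt_irrefl _)

theorem exists_promotion {n m : ℕ} (hn : b₀ ≤ n) (h : pointState chk b₀ x n = (m + 1, n)) :
    ∃ b, b₀ ≤ b ∧ b < n ∧ pointState chk b₀ x b = (m, b) ∧ chk n (cellIndex n x) b = true := by
  rcases hn.eq_or_lt with rfl | hn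
  · rw [pointState_of_le le_rfl] at h
    simp at h
  obtain ⟨n, rfl⟩ : ∃ n', n = n' + 1 := ⟨n - 1, by omega⟩
  have hn' : b₀ ≤ n := by omega
  have h1 := h
  rw [pointState_succ, promotionStep] at h1
  split_ifs at h1 with hs
  · have hm : (pointState chk b₀ x n).1 = m := by simpa using h1
    refine ⟨_, le_pointState_snd n, hs.1, ?_, hs.2⟩
    rw [pointState_pointState_snd hn', ← hm]
  · have := pointState_snd_le (chk := chk) (x := x) hn'
    rw [h1] at this
    simp at this

/-- If the cells containing `x` are promoted again and again, each number of promotions is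
attained. -/
theorem exists_pointState_eq (h : ∀ b ≥ b₀, ∃ n > b, chk n (cellIndex n x) b = true) (m : ℕ) :
    ∃ n ≥ b₀, pointState chk b₀ x n = (m, n) := by
  induction m with
  | zero => exact ⟨b₀, le_rfl, pointState_of_le le_rfl⟩
  | succ m ih =>
    obtain ⟨b, hb, hs⟩ := ih
    -- the first promotion after level `b` raises the count to `m + 1`
    have hex := h b hb
    classical
    obtain ⟨hn, hc⟩ := Nat.find_spec hex
    set n := Nat.find hex with hndef
    have hmin : ∀ l < n, ¬ (l > b ∧ chk l (cellIndex l x) b = true) :=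
      fun l hl => Nat.find_min hex hl
    have hstay : ∀ l, b ≤ l → l < n → pointState chk b₀ x l = (m, b) := by
      intro l hl
      induction l, hl using Nat.le_induction with
      | base => intro _; exact hs
      | succ l hl ih =>
        intro hln
        rw [pointState_succ, ih (by omega), promotionStep, if_neg]
        exact fun hc => hmin _ hln ⟨hc.1, hc.2⟩
    refine ⟨n, by omega, ?_⟩
    obtain ⟨l, hl⟩ : ∃ l, n = l + 1 := ⟨n - 1, by omega⟩
    rw [hl, pointState_succ, hstay l (by omega) (by omega), promotionStep, if_pos]
    exact ⟨by show b < l + 1; omega, by rw [← hl]; exact hc⟩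

end Promotion

/-- The cells inside the cell `a₀` of level `b₀` at which the count of promotions becomes `m`. -/
def promotedCells (chk : ℕ → ℕ → ℕ → Bool) (b₀ a₀ m : ℕ) : Set (ℕ × ℕ) :=
  {p | b₀ ≤ p.1 ∧ p.2 / 2 ^ (p.1 - b₀) = a₀ ∧ cellState chk b₀ p.1 p.2 = (m, p.1)}

section Promotion

variable {chk : ℕ → ℕ → ℕ → Bool} {b₀ a₀ : ℕ}

theorem mem_promotedCells {m : ℕ} {p : ℕ × ℕ} (hp : p ∈ promotedCells chk b₀ a₀ m) {x : ℝ}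
    (hx : x ∈ dyadicCell p.1 p.2) :
    b₀ ≤ p.1 ∧ cellIndex b₀ x = a₀ ∧ pointState chk b₀ x p.1 = (m, p.1) := by
  obtain ⟨h1, h2, h3⟩ := hp
  rw [← cellIndex_of_mem hx] at h2 h3
  rw [cellIndex_div h1] at h2
  rw [cellState_cellIndex] at h3
  exact ⟨h1, h2, h3⟩

theorem promotedCells_of_point {m n : ℕ} {x : ℝ} (hn : b₀ ≤ n) (h0 : cellIndex b₀ x = a₀)
    (h : pointState chk b₀ x n = (m, n)) : (n, cellIndex n x) ∈ promotedCells chk b₀ a₀ m :=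
  ⟨hn, by rw [cellIndex_div hn, h0], by rw [cellState_cellIndex, h]⟩

theorem pairwise_disjoint_promotedCells (m : ℕ) :
    (promotedCells chk b₀ a₀ m).PairwiseDisjoint fun p => dyadicCell p.1 p.2 := by
  intro p hp q hq hpq
  refine Set.disjoint_left.2 fun x hxp hxq => hpq ?_
  have h1 : p.1 = q.1 := level_unique (mem_promotedCells hp hxp).2.2 (mem_promotedCells hq hxq).2.2
  refine Prod.ext h1 ?_
  rw [← cellIndex_of_mem hxp, ← cellIndex_of_mem hxq, h1]

/-- The total length of the cells that are promoted `m` times decays like `c ^ m`, if every cell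
promotes at most a fraction `c` of itself. -/
theorem tsum_promotedCells_le {c : ℝ≥0∞}
    (H : ∀ b ≥ b₀, ∀ a, a / 2 ^ (b - b₀) = a₀ →
      volume {x ∈ dyadicCell b a | ∃ n > b, chk n (cellIndex n x) b = true} ≤
        c * (2 : ℝ≥0∞)⁻¹ ^ b) (m : ℕ) :
    ∑' p : promotedCells chk b₀ a₀ m, (2 : ℝ≥0∞)⁻¹ ^ p.1.1 ≤ c ^ m := by
  have hvol : ∀ m, ∑' p : promotedCells chk b₀ a₀ m, (2 : ℝ≥0∞)⁻¹ ^ p.1.1 =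
      volume (⋃ p ∈ promotedCells chk b₀ a₀ m, dyadicCell p.1 p.2) := by
    intro m
    rw [measure_biUnion (to_countable _) (pairwise_disjoint_promotedCells m)
      fun p _ => measurableSet_dyadicCell _ _]
    simp only [volume_dyadicCell]
  induction m with
  | zero =>
    rw [hvol, pow_zero]
    calc volume (⋃ p ∈ promotedCells chk b₀ a₀ 0, dyadicCell p.1 p.2)
        ≤ volume (dyadicCell b₀ a₀) := by
          refine measure_mono (iUnion₂_subset fun p hp x hx => ?_)
          exact (cellIndex_eq_iff (nonneg_of_mem_dyadicCell hx)).1 (mem_promotedCells hp hx).2.1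
      _ ≤ 1 := by
          rw [volume_dyadicCell]
          exact pow_le_one₀ (by simp) (by simp)
  | succ m ih =>
    rw [hvol]
    calc volume (⋃ p ∈ promotedCells chk b₀ a₀ (m + 1), dyadicCell p.1 p.2)
        ≤ volume (⋃ p : promotedCells chk b₀ a₀ m,
            {x ∈ dyadicCell p.1.1 p.1.2 | ∃ n > p.1.1, chk n (cellIndex n x) p.1.1 = true}) := by
          refine measure_mono (iUnion₂_subset fun p hp x hx => ?_)
          obtain ⟨h1, h2, h3⟩ := mem_promotedCells hp hx
          obtain ⟨b, hb, hbn, hs, hc⟩ := exists_promotion h1 h3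
          exact mem_iUnion.2 ⟨⟨_, promotedCells_of_point hb h2 hs⟩,
            mem_dyadicCell_cellIndex (nonneg_of_mem_dyadicCell hx), p.1, hbn, hc⟩
      _ ≤ ∑' p : promotedCells chk b₀ a₀ m, volume
            {x ∈ dyadicCell p.1.1 p.1.2 | ∃ n > p.1.1, chk n (cellIndex n x) p.1.1 = true} :=
          measure_iUnion_le _
      _ ≤ ∑' p : promotedCells chk b₀ a₀ m, c * (2 : ℝ≥0∞)⁻¹ ^ p.1.1 :=
          ENNReal.tsum_le_tsum fun p => H _ p.2.1 _ p.2.2.1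
      _ ≤ c ^ (m + 1) := by
          rw [ENNReal.tsum_mul_left, pow_succ']
          gcongr

theorem rePred_promotedCells
    (hchk : Computable fun q : ℕ × ℕ × ℕ => chk q.1 q.2.1 q.2.2) (b₀ a₀ : ℕ) :
    REPred fun q : ℕ × ℕ × ℕ => q.2 ∈ promotedCells chk b₀ a₀ q.1 := by
  have h1 : Computable fun q : ℕ × ℕ × ℕ => q.2.1 := Computable.fst.comp Computable.snd
  have h2 : Computable fun q : ℕ × ℕ × ℕ => q.2.2 := Computable.snd.comp Computable.snd
  refine (REPred.nat_le_of_computable (Computable.const b₀) h1).and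
    ((REPred.eq_of_computable (Primrec.nat_div.to_comp.comp h2 (Primrec.nat_pow.to_comp.comp
      (Computable.const 2) (Primrec.nat_sub.to_comp.comp h1 (Computable.const b₀))))
      (Computable.const a₀)).and ?_)
  exact REPred.eq_of_computable ((computable_cellState hchk b₀).comp h1 h2)
    (Computable.fst.pair h1)

/-- The code of the open interval `((a - 1) / 2 ^ n, (a + 1) / 2 ^ n)`, which contains the cell `a`
of level `n` and is twice as long. -/
def widenedCellCode (p : ℕ × ℕ) : ℤ × ℤ × ℕ := ((p.2 : ℤ) - 1, (p.2 : ℤ) + 1, 2 ^ p.1 - 1)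

theorem ratInterval_widenedCellCode (p : ℕ × ℕ) : ratInterval (widenedCellCode p) =
    Ioo (((p.2 : ℝ) - 1) / 2 ^ p.1) (((p.2 : ℝ) + 1) / 2 ^ p.1) := by
  simp only [ratInterval, widenedCellCode]
  push_cast [Nat.one_le_two_pow]
  simp

theorem primrec_widenedCellCode : Primrec widenedCellCode := by
  have ha : Primrec fun p : ℕ × ℕ => (p.2 : ℤ) := Primrec.int_natCast.comp Primrec.snd
  exact (Primrec.int_sub.comp ha (Primrec.const 1)).pair
    ((Primrec.int_add.comp ha (Primrec.const 1)).pair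
      (Primrec.nat_sub.comp (Primrec.nat_pow.comp (Primrec.const 2) Primrec.fst)
        (Primrec.const 1)))

theorem rePred_widened_promotedCells
    (hchk : Computable fun q : ℕ × ℕ × ℕ => chk q.1 q.2.1 q.2.2) (b₀ a₀ r : ℕ) :
    REPred fun q : ℕ × (ℤ × ℤ × ℕ) =>
      ∃ p : ℕ × ℕ, p ∈ promotedCells chk b₀ a₀ (r * (q.1 + 1)) ∧ q.2 = widenedCellCode p := by
  have hm : Computable fun q : (ℕ × (ℤ × ℤ × ℕ)) × (ℕ × ℕ) => r * (q.1.1 + 1) :=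
    Primrec.nat_mul.to_comp.comp (Computable.const r)
      (Computable.succ.comp (Computable.fst.comp Computable.fst))
  have h1 := (rePred_promotedCells hchk b₀ a₀).comp (hm.pair Computable.snd)
  have h2 : REPred fun q : (ℕ × (ℤ × ℤ × ℕ)) × (ℕ × ℕ) => q.1.2 = widenedCellCode q.2 :=
    REPred.eq_of_computable (Computable.snd.comp Computable.fst)
      (primrec_widenedCellCode.to_comp.comp Computable.snd)
  exact (h1.and h2).exists_right

end Promotion

/-- A random real escapes every computable promotion rule that, inside each cell, promotes at most
a fixed fraction `c < 1` of the cell: there is a cell containing `X` in which no smaller cell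
containing `X` is promoted. Otherwise the sets of points with at least `m` promotions would, for
a subsequence of the `m`, form a Martin-Löf test that captures `X`. -/
theorem IsMartinLofRandom.exists_no_promotion {X : ℝ} (hX : IsMartinLofRandom X)
    {chk : ℕ → ℕ → ℕ → Bool} (hchk : Computable fun q : ℕ × ℕ × ℕ => chk q.1 q.2.1 q.2.2)
    {c : ℝ≥0∞} (hc : c < 1) (b₀ : ℕ)
    (H : ∀ b ≥ b₀, ∀ a, a / 2 ^ (b - b₀) = cellIndex b₀ X →
      volume {x ∈ dyadicCell b a | ∃ n > b, chk n (cellIndex n x) b = true} ≤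
        c * (2 : ℝ≥0∞)⁻¹ ^ b) :
    ∃ b ≥ b₀, ∀ n > b, chk n (cellIndex n X) b = false := by
  by_contra! hcon
  simp only [ne_eq, Bool.not_eq_false] at hcon
  obtain ⟨r, hr⟩ : ∃ r : ℕ, c ^ r ≤ (2 : ℝ≥0∞)⁻¹ := by
    have := (ENNReal.tendsto_pow_atTop_nhds_zero_of_lt_one hc).eventually
      (Iic_mem_nhds (show (0 : ℝ≥0∞) < 2⁻¹ by simp))
    exact this.exists
  set E := promotedCells chk b₀ (cellIndex b₀ X) with hE
  let W : ℕ × (ℤ × ℤ × ℕ) → Prop := fun q =>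
    ∃ p : ℕ × ℕ, p ∈ E (r * (q.1 + 1)) ∧ q.2 = widenedCellCode p
  have hW : REPred W := rePred_widened_promotedCells hchk b₀ (cellIndex b₀ X) r
  have hunion : ∀ m, (⋃ c, ⋃ (_ : W (m, c)), ratInterval c) =
      ⋃ p : E (r * (m + 1)), ratInterval (widenedCellCode p) := by
    intro m
    ext y
    simp only [mem_iUnion, W]
    constructor
    · rintro ⟨_, ⟨p, hp, rfl⟩, hy⟩
      exact ⟨⟨p, hp⟩, hy⟩
    · rintro ⟨⟨p, hp⟩, hy⟩
      exact ⟨_, ⟨p, hp, rfl⟩, hy⟩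
  refine hX.2 (fun m => Icc 0 1 ∩ ⋃ c, ⋃ (_ : W (m, c)), ratInterval c)
    ⟨⟨W, hW, fun _ => rfl⟩, fun m => ?_⟩ (mem_iInter.2 fun m => ⟨hX.1, ?_⟩)
  · have hlen : ∀ p : ℕ × ℕ, volume (ratInterval (widenedCellCode p)) = 2 * (2 : ℝ≥0∞)⁻¹ ^ p.1 := by
      intro p
      rw [ratInterval_widenedCellCode, Real.volume_Ioo, ← sub_div,
        show ((p.2 : ℝ) + 1 - (p.2 - 1)) / 2 ^ p.1 = 2 * (2⁻¹) ^ p.1 by rw [inv_pow]; ring,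
        ENNReal.ofReal_mul (by norm_num),
        ENNReal.ofReal_pow (by norm_num), ENNReal.ofReal_inv_of_pos (by norm_num)]
      simp
    calc volume (Icc 0 1 ∩ ⋃ c, ⋃ (_ : W (m, c)), ratInterval c)
        ≤ volume (⋃ p : E (r * (m + 1)), ratInterval (widenedCellCode p)) := by
          rw [hunion]
          exact measure_mono inter_subset_right
      _ ≤ ∑' p : E (r * (m + 1)), volume (ratInterval (widenedCellCode p)) := measure_iUnion_le _
      _ = 2 * ∑' p : E (r * (m + 1)), (2 : ℝ≥0∞)⁻¹ ^ p.1.1 := by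
          simp only [hlen, ENNReal.tsum_mul_left]
      _ ≤ 2 * c ^ (r * (m + 1)) := by gcongr; exact tsum_promotedCells_le H _
      _ ≤ 2 * (2⁻¹) ^ (m + 1) := by rw [pow_mul]; gcongr
      _ = (2 : ℝ≥0∞)⁻¹ ^ m := by
          rw [pow_succ', ← mul_assoc, ENNReal.mul_inv_cancel (by norm_num) (by norm_num), one_mul]
  · rw [hunion]
    obtain ⟨n, hn, hs⟩ := exists_pointState_eq hcon (r * (m + 1))
    refine mem_iUnion.2 ⟨⟨_, promotedCells_of_point hn rfl hs⟩, ?_⟩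
    rw [ratInterval_widenedCellCode]
    obtain ⟨h1, h2⟩ := mem_dyadicCell_cellIndex (n := n) hX.1.1
    refine ⟨lt_of_lt_of_le ?_ h1, h2⟩
    gcongr
    linarith

/-! ### Enumerations of cells by stages -/

theorem Computable.exists_lt {α : Type*} [Primcodable α] {f : α → ℕ → Bool} (hf : Computable₂ f)
    {g : α → ℕ} (hg : Computable g) :
    Computable fun a => decide (∃ e < g a, f a e = true) := by
  have h : Computable fun a => (Nat.rec false (fun e ih => ih || f a e) (g a) : Bool) :=
    Computable.nat_rec (h := fun a p => p.2 || f a p.1) hg (Computable.const false)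
      (Primrec.or.to_comp.comp (Computable.snd.comp Computable.snd)
        (hf.comp Computable.fst (Computable.fst.comp Computable.snd)))
  refine h.of_eq fun a => ?_
  induction g a with
  | zero => simp
  | succ n ih =>
    simp only [ih, Nat.lt_succ_iff_lt_or_eq, or_and_right, exists_or, exists_eq_left,
      Bool.decide_or, Bool.decide_eq_true]

theorem Computable.sum_range {α : Type*} [Primcodable α] {f : α → ℕ → ℕ} (hf : Computable₂ f)
    {g : α → ℕ} (hg : Computable g) :
    Computable fun a => ∑ j ∈ Finset.range (g a), f a j := by
  have h : Computable fun a => (Nat.rec 0 (fun e ih => ih + f a e) (g a) : ℕ) :=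
    Computable.nat_rec (h := fun a p => p.2 + f a p.1) hg (Computable.const 0)
      (Primrec.nat_add.to_comp.comp (Computable.snd.comp Computable.snd)
        (hf.comp Computable.fst (Computable.fst.comp Computable.snd)))
  refine h.of_eq fun a => ?_
  induction g a with
  | zero => simp
  | succ n ih => rw [Finset.sum_range_succ, ← ih]

theorem Computable.div_two_pow_sub {α : Type*} [Primcodable α] {n a l : α → ℕ} (hn : Computable n)
    (ha : Computable a) (hl : Computable l) : Computable fun x => a x / 2 ^ (n x - l x) :=
  Primrec.nat_div.to_comp.comp ha (Primrec.nat_pow.to_comp.comp (Computable.const 2)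
    (Primrec.nat_sub.to_comp.comp hn hl))

/-- The union of a recursively enumerable set of dyadic cells is the increasing union of a
computable sequence of finite unions of cells, the `n`-th one consisting of cells of level `n`. -/
theorem exists_monotone_stage {E : ℕ → ℕ → Prop} (hE : REPred fun p : ℕ × ℕ => E p.1 p.2) :
    ∃ R : ℕ → ℕ → Bool, Computable₂ R ∧
      (∀ x n n', n ≤ n' → R n (cellIndex n x) = true → R n' (cellIndex n' x) = true) ∧
      ∀ x, (∃ n, R n (cellIndex n x) = true) ↔ ∃ l, E l (cellIndex l x) := by
  obtain ⟨g, hg, hgE⟩ := hE.exists_stage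
  have hR : Computable fun p : ℕ × ℕ => decide (∃ e < p.1,
      g (e.unpair.1, p.2 / 2 ^ (p.1 - e.unpair.1)) e.unpair.2 = true) := by
    refine Computable.exists_lt (f := fun (p : ℕ × ℕ) e =>
      g (e.unpair.1, p.2 / 2 ^ (p.1 - e.unpair.1)) e.unpair.2) ?_ Computable.fst
    have h1 : Computable fun q : (ℕ × ℕ) × ℕ => q.2.unpair.1 :=
      Computable.fst.comp (Computable.unpair.comp Computable.snd)
    exact hg.comp (h1.pair (Computable.div_two_pow_sub (Computable.fst.comp Computable.fst)
      (Computable.snd.comp Computable.fst) h1))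
      (Computable.snd.comp (Computable.unpair.comp Computable.snd))
  have key : ∀ x n, decide (∃ e < n,
      g (e.unpair.1, cellIndex n x / 2 ^ (n - e.unpair.1)) e.unpair.2 = true) = true ↔
      ∃ e < n, g (e.unpair.1, cellIndex e.unpair.1 x) e.unpair.2 = true := by
    intro x n
    rw [decide_eq_true_eq]
    refine exists_congr fun e => and_congr_right fun he => ?_
    rw [cellIndex_div ((Nat.unpair_left_le e).trans he.le)]
  refine ⟨fun n a => decide (∃ e < n,
      g (e.unpair.1, a / 2 ^ (n - e.unpair.1)) e.unpair.2 = true), hR, ?_, fun x => ?_⟩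
  · intro x n n' hn h
    rw [key] at h ⊢
    obtain ⟨e, he, h⟩ := h
    exact ⟨e, he.trans_le hn, h⟩
  · simp only [key]
    constructor
    · rintro ⟨n, e, -, h⟩
      exact ⟨_, (hgE (_, _)).2 ⟨_, h⟩⟩
    · rintro ⟨l, h⟩
      obtain ⟨s, h⟩ := (hgE (l, cellIndex l x)).1 h
      exact ⟨_, Nat.pair l s, Nat.lt_succ_self _, by simpa using h⟩

/-- The version of `IsMartinLofRandom.exists_no_promotion` for recursively enumerable rules: `E b`
is an enumeration of cells, used inside the cells of level `b`. -/
theorem IsMartinLofRandom.exists_not_enumerated {X : ℝ} (hX : IsMartinLofRandom X)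
    {E : ℕ → ℕ → ℕ → Prop} (hE : REPred fun q : ℕ × ℕ × ℕ => E q.1 q.2.1 q.2.2)
    {c : ℝ≥0∞} (hc : c < 1) (b₀ : ℕ)
    (H : ∀ b ≥ b₀, ∀ a, a / 2 ^ (b - b₀) = cellIndex b₀ X →
      volume {x ∈ dyadicCell b a | ∃ l, E b l (cellIndex l x)} ≤ c * (2 : ℝ≥0∞)⁻¹ ^ b) :
    ∃ b ≥ b₀, ∀ l, ¬ E b l (cellIndex l X) := by
  obtain ⟨g, hg, hgE⟩ := hE.exists_stage
  -- level `n = ⟨l, s, r⟩` of the promotion process looks at stage `s` of the enumeration of the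
  -- cells of level `l`; the padding `r` makes each pair `(l, s)` occur at arbitrarily large levels
  let chk : ℕ → ℕ → ℕ → Bool := fun n a b =>
    g (b, n.unpair.1, a / 2 ^ (n - n.unpair.1)) n.unpair.2.unpair.1
  have hchk : Computable fun q : ℕ × ℕ × ℕ => chk q.1 q.2.1 q.2.2 := by
    have h1 : Computable fun q : ℕ × ℕ × ℕ => q.1.unpair.1 :=
      Computable.fst.comp (Computable.unpair.comp Computable.fst)
    have h2 : Computable fun q : ℕ × ℕ × ℕ => q.1.unpair.2.unpair.1 :=
      Computable.fst.comp (Computable.unpair.comp (Computable.snd.comp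
        (Computable.unpair.comp Computable.fst)))
    exact hg.comp ((Computable.snd.comp Computable.snd).pair (h1.pair
      (Computable.div_two_pow_sub Computable.fst (Computable.fst.comp Computable.snd) h1))) h2
  have hchk_iff : ∀ x n b, chk n (cellIndex n x) b =
      g (b, n.unpair.1, cellIndex n.unpair.1 x) n.unpair.2.unpair.1 := by
    intro x n b
    simp only [chk]
    rw [cellIndex_div (Nat.unpair_left_le n)]
  obtain ⟨b, hb, h⟩ := hX.exists_no_promotion hchk hc b₀ fun b hb a ha => by
    refine le_trans (measure_mono ?_) (H b hb a ha)
    rintro x ⟨hx, n, -, hn⟩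
    rw [hchk_iff] at hn
    exact ⟨hx, _, (hgE (b, _, _)).2 ⟨_, hn⟩⟩
  refine ⟨b, hb, fun l hl => ?_⟩
  obtain ⟨s, hs⟩ := (hgE (b, l, cellIndex l X)).1 hl
  have hlt : b < Nat.pair l (Nat.pair s (b + 1)) :=
    (Nat.right_le_pair s (b + 1)).trans (Nat.right_le_pair l _)
  have := h _ hlt
  rw [hchk_iff] at this
  simp only [Nat.unpair_pair] at this
  rw [hs] at this
  exact absurd this (by simp)

/-- The cells of index `2 ^ n` shrink to the point `1` fast enough to be a promotion rule. -/
theorem IsMartinLofRandom.lt_one {X : ℝ} (hX : IsMartinLofRandom X) : X < 1 := by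
  refine lt_of_le_of_ne hX.1.2 ?_
  rintro rfl
  have hchk : Computable fun q : ℕ × ℕ × ℕ => decide (q.2.1 = 2 ^ q.1) :=
    (Primrec.eq.decide.comp (Primrec.fst.comp Primrec.snd)
      (Primrec.nat_pow.comp (Primrec.const 2) Primrec.fst)).to_comp
  obtain ⟨b, -, h⟩ := hX.exists_no_promotion (chk := fun n a _ => decide (a = 2 ^ n)) hchk
    (c := 2⁻¹) (by simp) 0 fun b _ a _ => by
      refine (measure_mono (t := Ico (1 : ℝ) (1 + (2⁻¹) ^ (b + 1))) ?_).trans ?_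
      · rintro x ⟨hx, n, hn, hxn⟩
        rw [decide_eq_true_eq, cellIndex_eq_iff (nonneg_of_mem_dyadicCell hx)] at hxn
        obtain ⟨h1, h2⟩ := hxn
        push_cast at h1 h2
        rw [div_self (by positivity)] at h1
        rw [add_div, div_self (by positivity), one_div, ← inv_pow] at h2
        refine ⟨h1, h2.trans_le ?_⟩
        have : (2⁻¹ : ℝ) ^ n ≤ 2⁻¹ ^ (b + 1) :=
          pow_le_pow_of_le_one (by norm_num) (by norm_num) hn
        linarith
      · rw [Real.volume_Ico, add_sub_cancel_left, ENNReal.ofReal_pow (by norm_num),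
          ENNReal.ofReal_inv_of_pos (by norm_num), pow_succ']
        simp
  have := h (b + 1) (by omega)
  have h1 : cellIndex (b + 1) (1 : ℝ) = 2 ^ (b + 1) := by
    rw [cellIndex, one_mul]
    exact_mod_cast Nat.floor_natCast (R := ℝ) (2 ^ (b + 1))
  simp [h1] at this

/-! ### Density -/

theorem mem_dyadicCell_add_iff {b n : ℕ} (h : b ≤ n) (a : ℕ) {x : ℝ} (hx : 0 ≤ x) :
    x ∈ dyadicCell b a ↔ ∃ j < 2 ^ (n - b), cellIndex n x = a * 2 ^ (n - b) + j := by
  rw [← cellIndex_eq_iff hx, ← cellIndex_div h]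
  have hpos : 0 < 2 ^ (n - b) := by positivity
  constructor
  · rintro rfl
    exact ⟨cellIndex n x % 2 ^ (n - b), Nat.mod_lt _ hpos, (Nat.div_add_mod' _ _).symm⟩
  · rintro ⟨j, hj, h⟩
    rw [h, mul_comm, Nat.mul_add_div hpos, Nat.div_eq_of_lt hj, add_zero]

/-- The number of cells of level `n` inside the cell `a` of level `b` that satisfy `R`. -/
def cellCount (R : ℕ → ℕ → Bool) (n b a : ℕ) : ℕ :=
  ∑ j ∈ Finset.range (2 ^ (n - b)), (R n (a * 2 ^ (n - b) + j)).toNat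

theorem computable_cellCount {R : ℕ → ℕ → Bool} (hR : Computable₂ R) :
    Computable fun q : ℕ × ℕ × ℕ => cellCount R q.1 q.2.1 q.2.2 := by
  have hpow : Computable fun q : ℕ × ℕ × ℕ => 2 ^ (q.1 - q.2.1) :=
    Primrec.nat_pow.to_comp.comp (Computable.const 2)
      (Primrec.nat_sub.to_comp.comp Computable.fst (Computable.fst.comp Computable.snd))
  have hidx : Computable fun q : (ℕ × ℕ × ℕ) × ℕ => q.1.2.2 * 2 ^ (q.1.1 - q.1.2.1) + q.2 :=
    Primrec.nat_add.to_comp.comp (Primrec.nat_mul.to_comp.comp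
      (Computable.snd.comp (Computable.snd.comp Computable.fst)) (hpow.comp Computable.fst))
      Computable.snd
  have hterm : Computable₂ fun (q : ℕ × ℕ × ℕ) j =>
      (R q.1 (q.2.2 * 2 ^ (q.1 - q.2.1) + j)).toNat :=
    (Primrec.dom_bool Bool.toNat).to_comp.comp
      (hR.comp (Computable.fst.comp Computable.fst) hidx)
  exact Computable.sum_range hterm hpow

/-- The promotion rule for detecting density: inside a cell of level `b`, once the cells of level
`n` that satisfy `R` fill more than a `K`-th part of it, those that do not satisfy `R` are
promoted. -/
def densityRule (R : ℕ → ℕ → Bool) (K n a b : ℕ) : Bool :=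
  !(R n a) && decide (2 ^ (n - b) < K * cellCount R n b (a / 2 ^ (n - b)))

theorem computable_densityRule {R : ℕ → ℕ → Bool} (hR : Computable₂ R) (K : ℕ) :
    Computable fun q : ℕ × ℕ × ℕ => densityRule R K q.1 q.2.1 q.2.2 := by
  have hb : Computable fun q : ℕ × ℕ × ℕ => q.2.2 := Computable.snd.comp Computable.snd
  have ha : Computable fun q : ℕ × ℕ × ℕ => q.2.1 := Computable.fst.comp Computable.snd
  have hpow : Computable fun q : ℕ × ℕ × ℕ => 2 ^ (q.1 - q.2.2) :=
    Primrec.nat_pow.to_comp.comp (Computable.const 2)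
      (Primrec.nat_sub.to_comp.comp Computable.fst hb)
  have hcnt := (computable_cellCount hR).comp
    (Computable.fst.pair (hb.pair (Computable.div_two_pow_sub Computable.fst ha hb)))
  have hlt : Computable fun q : ℕ × ℕ × ℕ =>
      decide (2 ^ (q.1 - q.2.2) < K * cellCount R q.1 q.2.2 (q.2.1 / 2 ^ (q.1 - q.2.2))) :=
    Primrec.nat_lt.decide.to_comp.comp hpow
      (Primrec.nat_mul.to_comp.comp (Computable.const K) hcnt)
  exact Primrec.and.to_comp.comp (Primrec.not.to_comp.comp (hR.comp Computable.fst ha)) hlt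

theorem densityRule_iff {R : ℕ → ℕ → Bool} {K n b : ℕ} (hn : b < n) (x : ℝ) :
    densityRule R K n (cellIndex n x) b = true ↔
      R n (cellIndex n x) = false ∧ 2 ^ (n - b) < K * cellCount R n b (cellIndex b x) := by
  simp only [densityRule, Bool.and_eq_true, Bool.not_eq_true', decide_eq_true_eq,
    cellIndex_div hn.le]

theorem inv_two_pow_eq_mul {b n : ℕ} (h : b ≤ n) :
    (2 : ℝ≥0∞)⁻¹ ^ b = (2 ^ (n - b) : ℕ) * (2 : ℝ≥0∞)⁻¹ ^ n := by
  obtain ⟨c, rfl⟩ := Nat.exists_eq_add_of_le h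
  rw [Nat.add_sub_cancel_left, pow_add, mul_left_comm, Nat.cast_pow, Nat.cast_ofNat, ← mul_pow,
    ENNReal.mul_inv_cancel (by norm_num) (by norm_num), one_pow, mul_one]

/-- The measure of a union of cells of level `n` inside a cell of level `b`, by counting. -/
theorem volume_cells_eq_count (R : ℕ → ℕ → Bool) {b n : ℕ} (h : b ≤ n) (a : ℕ) :
    volume {x ∈ dyadicCell b a | R n (cellIndex n x) = true} =
      (cellCount R n b a : ℝ≥0∞) *
        (2 : ℝ≥0∞)⁻¹ ^ n := by
  have hset : {x ∈ dyadicCell b a | R n (cellIndex n x) = true} =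
      ⋃ j ∈ (Finset.range (2 ^ (n - b))).filter fun j => R n (a * 2 ^ (n - b) + j) = true,
        dyadicCell n (a * 2 ^ (n - b) + j) := by
    ext x
    simp only [mem_ofPred_eq, mem_iUnion, Finset.mem_filter, Finset.mem_range, exists_prop]
    constructor
    · rintro ⟨hx, hR⟩
      have hx0 := nonneg_of_mem_dyadicCell hx
      obtain ⟨j, hj, hxj⟩ := (mem_dyadicCell_add_iff h a hx0).1 hx
      exact ⟨j, ⟨hj, hxj ▸ hR⟩, (cellIndex_eq_iff hx0).1 hxj⟩
    · rintro ⟨j, ⟨hj, hR⟩, hx⟩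
      have hxj := cellIndex_of_mem hx
      exact ⟨(mem_dyadicCell_add_iff h a (nonneg_of_mem_dyadicCell hx)).2 ⟨j, hj, hxj⟩,
        hxj ▸ hR⟩
  rw [hset, measure_biUnion_finset]
  · simp only [volume_dyadicCell, Finset.sum_const, nsmul_eq_mul]
    congr 2
    rw [cellCount, Finset.card_filter]
    exact Finset.sum_congr rfl fun j _ => by cases R n (a * 2 ^ (n - b) + j) <;> rfl
  · intro i _ j _ hij
    refine Set.disjoint_left.2 fun x hi hj => hij ?_
    have := (cellIndex_of_mem hi).symm.trans (cellIndex_of_mem hj)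
    omega
  · exact fun j _ => measurableSet_dyadicCell _ _

/-- A random real outside the union `B` of a recursively enumerable set of cells lies in cells in
which `B` has arbitrarily small density. Otherwise `B` eventually fills more than a fixed fraction
of every cell around `X`; promoting, at the first level where this becomes visible, the cells that
are not yet in `B` is a promotion rule of the kind that random reals escape. -/
theorem IsMartinLofRandom.exists_small_density {X : ℝ} (hX : IsMartinLofRandom X)
    {E : ℕ → ℕ → Prop} (hE : REPred fun p : ℕ × ℕ => E p.1 p.2)
    (hXE : ∀ l, ¬ E l (cellIndex l X)) {K : ℕ} (hK : 0 < K) :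
    ∃ b, volume {x ∈ dyadicCell b (cellIndex b X) | ∃ l, E l (cellIndex l x)} ≤
      (2 : ℝ≥0∞)⁻¹ ^ b / K := by
  obtain ⟨R, hR, hmono, hRE⟩ := exists_monotone_stage hE
  have hK0 : (K : ℝ≥0∞) ≠ 0 := by exact_mod_cast hK.ne'
  have hKt : (K : ℝ≥0∞) ≠ ⊤ := ENNReal.natCast_ne_top K
  obtain ⟨b, -, h⟩ := hX.exists_no_promotion (computable_densityRule hR K) (c := 1 - (K : ℝ≥0∞)⁻¹)
    (ENNReal.sub_lt_self ENNReal.one_ne_top one_ne_zero (ENNReal.inv_ne_zero.2 hKt)) 0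
    fun b _ a _ => by
      by_cases hex : ∃ n, b < n ∧ 2 ^ (n - b) < K * cellCount R n b a
      · classical
        obtain ⟨hn, hc⟩ := Nat.find_spec hex
        set n := Nat.find hex
        have hsub : {x ∈ dyadicCell b a | ∃ n > b, densityRule R K n (cellIndex n x) b = true} ⊆
            dyadicCell b a \ {x ∈ dyadicCell b a | R n (cellIndex n x) = true} := by
          rintro x ⟨hx, n', hn', hxn⟩
          rw [densityRule_iff hn' x, cellIndex_of_mem hx] at hxn
          refine ⟨hx, fun hxR => ?_⟩
          have := hmono x n n' (Nat.find_min' hex ⟨hn', hxn.2⟩) hxR.2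
          rw [hxn.1] at this
          exact absurd this (by simp)
        have hvol := volume_cells_eq_count R hn.le a
        have hsub' : {x ∈ dyadicCell b a | R n (cellIndex n x) = true} ⊆ dyadicCell b a :=
          fun x hx => hx.1
        have hmeas : MeasurableSet {x ∈ dyadicCell b a | R n (cellIndex n x) = true} :=
          (measurableSet_dyadicCell b a).inter
            ((Nat.measurable_floor.comp (measurable_id.mul_const _))
              (MeasurableSet.of_discrete (s := {i | R n i = true})))
        refine (measure_mono hsub).trans ?_
        rw [measure_sdiff hsub' hmeas.nullMeasurableSet (by rw [hvol]; finiteness),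
          volume_dyadicCell, ENNReal.sub_mul (by simp), one_mul]
        refine tsub_le_tsub_left ?_ _
        rw [hvol, mul_comm, ← div_eq_mul_inv, inv_two_pow_eq_mul hn.le]
        refine ENNReal.div_le_of_le_mul ?_
        rw [mul_right_comm]
        refine mul_le_mul_left ?_ _
        rw [mul_comm]
        exact_mod_cast hc.le
      · have hempty :
            {x ∈ dyadicCell b a | ∃ n > b, densityRule R K n (cellIndex n x) b = true} = ∅ := by
          refine Set.eq_empty_of_forall_notMem ?_
          rintro x ⟨hx, n', hn', hxn⟩
          rw [densityRule_iff hn' x, cellIndex_of_mem hx] at hxn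
          exact hex ⟨n', hn', hxn.2⟩
        rw [hempty, measure_empty]
        exact zero_le
  refine ⟨b, ?_⟩
  have hbound : ∀ n > b, volume {x ∈ dyadicCell b (cellIndex b X) |
      R n (cellIndex n x) = true} ≤ (2 : ℝ≥0∞)⁻¹ ^ b / K := by
    intro n hn
    have hXR : R n (cellIndex n X) = false := by
      by_contra hcon
      obtain ⟨l, hl⟩ := (hRE X).1 ⟨n, by simpa using hcon⟩
      exact hXE l hl
    have h1 := h n hn
    rw [← Bool.not_eq_true, densityRule_iff hn X, not_and, not_lt] at h1
    have h2 := h1 hXR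
    rw [volume_cells_eq_count R hn.le, ENNReal.le_div_iff_mul_le (Or.inl hK0) (Or.inl hKt),
      inv_two_pow_eq_mul hn.le, mul_right_comm]
    refine mul_le_mul_left ?_ _
    rw [mul_comm]
    exact_mod_cast h2
  have hU : {x ∈ dyadicCell b (cellIndex b X) | ∃ l, E l (cellIndex l x)} =
      ⋃ n, {x ∈ dyadicCell b (cellIndex b X) | R n (cellIndex n x) = true} := by
    ext x
    simp only [mem_ofPred_eq, mem_iUnion, ← hRE, exists_and_left]
  have hM : Monotone fun n => {x ∈ dyadicCell b (cellIndex b X) | R n (cellIndex n x) = true} :=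
    fun n n' hn x hx => ⟨hx.1, hmono x n n' hn hx.2⟩
  rw [hU, hM.measure_iUnion]
  refine iSup_le fun n => (measure_mono (hM (le_max_left n (b + 1)))).trans ?_
  exact hbound _ (lt_of_lt_of_le (Nat.lt_succ_self b) (le_max_right _ _))

/-! ### Progressions that meet an open set -/

/-- If the steps `τ j` are so far apart that the translates of an interval `[u, v)` by `τ j * i`
are disjoint for fixed `i`, then the points of the interval from which every progression
`x + τ j, …, x + τ j * k` meets `B` form a set of small measure, since each of them is counted
once for each `j` in the part of `B` covered by the translates. -/
theorem card_mul_volume_progression_le {B J : Set ℝ} (hB : MeasurableSet B) (u v : ℝ)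
    (τ : ℕ → ℝ) (M k : ℕ)
    (hτ : ∀ j < M, ∀ j' < M, j ≠ j' → v - u ≤ |τ j - τ j'|)
    (hJ : ∀ j < M, ∀ i < k, ∀ x ∈ Ico u v, x + τ j * (i + 1 : ℕ) ∈ J) :
    (M : ℝ≥0∞) * volume {x ∈ Ico u v | ∀ j < M, ∃ i < k, x + τ j * (i + 1 : ℕ) ∈ B} ≤
      k * volume (B ∩ J) := by
  -- the translates, and the part of `B` in each of them
  let T : ℕ → ℕ → Set ℝ := fun i j => B ∩ (fun y => y + -(τ j * (i + 1 : ℕ))) ⁻¹' Ico u v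
  have hT : ∀ i j, MeasurableSet (T i j) := fun i j =>
    hB.inter ((measurable_id.add_const _) measurableSet_Ico)
  set V := {x ∈ Ico u v | ∀ j < M, ∃ i < k, x + τ j * (i + 1 : ℕ) ∈ B}
  have hV : ∀ j ∈ Finset.range M, volume V ≤ ∑ i ∈ Finset.range k, volume (T i j) := by
    intro j hj
    have hsub : V ⊆ ⋃ i ∈ Finset.range k, (fun x => x + τ j * (i + 1 : ℕ)) ⁻¹' T i j := by
      rintro x ⟨hx, h⟩
      obtain ⟨i, hi, hxB⟩ := h j (Finset.mem_range.1 hj)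
      refine mem_biUnion (Finset.mem_coe.2 (Finset.mem_range.2 hi)) ⟨hxB, ?_⟩
      show x + τ j * (i + 1 : ℕ) + -(τ j * (i + 1 : ℕ)) ∈ Ico u v
      rwa [add_neg_cancel_right]
    refine (measure_mono hsub).trans ((measure_biUnion_finset_le _ _).trans ?_)
    exact Finset.sum_le_sum fun i _ => (measure_preimage_add_right _ _ _).le
  have hsum : ∀ i ∈ Finset.range k, ∑ j ∈ Finset.range M, volume (T i j) ≤ volume (B ∩ J) := by
    intro i hi
    rw [← measure_biUnion_finset _ fun j _ => hT i j]
    · refine measure_mono (iUnion₂_subset fun j hj y hy => ⟨hy.1, ?_⟩)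
      have := hJ j (Finset.mem_range.1 hj) i (Finset.mem_range.1 hi) _ hy.2
      rwa [neg_add_cancel_right] at this
    · intro j hj j' hj' hne
      refine Set.disjoint_left.2 fun y hy hy' => ?_
      have h1 : u ≤ y + -(τ j * (i + 1 : ℕ)) ∧ y + -(τ j * (i + 1 : ℕ)) < v := hy.2
      have h2 : u ≤ y + -(τ j' * (i + 1 : ℕ)) ∧ y + -(τ j' * (i + 1 : ℕ)) < v := hy'.2
      have h3 := hτ j (Finset.mem_range.1 hj) j' (Finset.mem_range.1 hj') hne
      have h4 : |τ j - τ j'| * (i + 1 : ℕ) < v - u := by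
        rw [← Nat.abs_cast (i + 1), ← abs_mul, abs_lt]
        constructor <;> linarith
      have h5 : |τ j - τ j'| ≤ |τ j - τ j'| * (i + 1 : ℕ) :=
        le_mul_of_one_le_right (abs_nonneg _) (by exact_mod_cast Nat.succ_pos i)
      linarith
  calc (M : ℝ≥0∞) * volume V = ∑ _j ∈ Finset.range M, volume V := by simp
    _ ≤ ∑ j ∈ Finset.range M, ∑ i ∈ Finset.range k, volume (T i j) := Finset.sum_le_sum hV
    _ = ∑ i ∈ Finset.range k, ∑ j ∈ Finset.range M, volume (T i j) := Finset.sum_comm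
    _ ≤ ∑ _i ∈ Finset.range k, volume (B ∩ J) := Finset.sum_le_sum hsum
    _ = k * volume (B ∩ J) := by simp

theorem tendsto_cellIndex_div {x : ℝ} (hx : 0 ≤ x) :
    Filter.Tendsto (fun n => (cellIndex n x : ℝ) / 2 ^ n) Filter.atTop (nhds x) := by
  have h0 : Filter.Tendsto (fun n : ℕ => x - (1 / 2 : ℝ) ^ n) Filter.atTop (nhds x) := by
    simpa using tendsto_const_nhds.sub
      (tendsto_pow_atTop_nhds_zero_of_lt_one (r := (1 / 2 : ℝ)) (by norm_num) (by norm_num))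
  refine tendsto_of_tendsto_of_tendsto_of_le_of_le h0 tendsto_const_nhds (fun n => ?_)
    fun n => (mem_dyadicCell_cellIndex hx).1
  have := (mem_dyadicCell_cellIndex (n := n) hx).2
  rw [add_div] at this
  rw [one_div_pow]
  exact (sub_lt_iff_lt_add.2 this).le

/-- The cells around `x` are eventually contained in every open interval around `x`. -/
theorem eventually_cell_subset {x s p q : ℝ} (hx : 0 ≤ x) (h : x + s ∈ Ioo p q) :
    ∀ᶠ n in Filter.atTop, p < (cellIndex n x : ℝ) / 2 ^ n + s ∧
      ((cellIndex n x : ℝ) + 1) / 2 ^ n + s < q := by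
  have h1 := (tendsto_cellIndex_div hx).add_const s
  have h2 : Filter.Tendsto (fun n => ((cellIndex n x : ℝ) + 1) / 2 ^ n + s) Filter.atTop
      (nhds (x + s)) := by
    have h0 : Filter.Tendsto (fun n : ℕ => (1 / 2 : ℝ) ^ n) Filter.atTop (nhds 0) :=
      tendsto_pow_atTop_nhds_zero_of_lt_one (by norm_num) (by norm_num)
    have := h1.add h0
    rw [add_zero] at this
    refine this.congr fun n => ?_
    rw [one_div_pow]
    ring
  exact (h1.eventually (lt_mem_nhds h.1)).and (h2.eventually (gt_mem_nhds h.2))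

section Cuts

variable {ι α : Type*} [Primcodable ι] [Primcodable α] {t : ι → ℝ}

/-- Numerator and denominator of the rational number that `t` is compared with when `p / (d + 1)`
is compared with `a / 2 ^ l + t * (i + 1)`. -/
def cutCode (p : ℤ) (d a l i : ℕ) : ℤ × ℕ :=
  (p * ((2 ^ l : ℕ) : ℤ) - (a : ℤ) * ((d + 1 : ℕ) : ℤ), (d + 1) * 2 ^ l * (i + 1) - 1)

theorem cutCode_eq (p : ℤ) (d a l i : ℕ) :
    ((cutCode p d a l i).1 : ℝ) / (((cutCode p d a l i).2 : ℝ) + 1) =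
      ((p : ℝ) / ((d : ℝ) + 1) - (a : ℝ) / 2 ^ l) / ((i + 1 : ℕ) : ℝ) := by
  have hpos : 1 ≤ (d + 1) * 2 ^ l * (i + 1) := Nat.one_le_iff_ne_zero.2 (by positivity)
  rw [cutCode, Nat.cast_sub hpos]
  push_cast
  rw [sub_add_cancel]
  have : (d : ℝ) + 1 ≠ 0 := by positivity
  field_simp

theorem computable_cutCode {p : α → ℤ} {d a l i : α → ℕ} (hp : Computable p)
    (hd : Computable d) (ha : Computable a) (hl : Computable l) (hi : Computable i) :
    Computable fun x => cutCode (p x) (d x) (a x) (l x) (i x) := by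
  have hpow := Primrec.nat_pow.to_comp.comp (Computable.const 2) hl
  have hd' := Computable.succ.comp hd
  have hnum := Primrec.int_sub.to_comp.comp
    (Primrec.int_mul.to_comp.comp hp (Primrec.int_natCast.to_comp.comp hpow))
    (Primrec.int_mul.to_comp.comp (Primrec.int_natCast.to_comp.comp ha)
      (Primrec.int_natCast.to_comp.comp hd'))
  have hden := Primrec.nat_sub.to_comp.comp (Primrec.nat_mul.to_comp.comp
    (Primrec.nat_mul.to_comp.comp hd' hpow) (Computable.succ.comp hi)) (Computable.const 1)
  exact hnum.pair hden

theorem rePred_lt_cell_add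
    (hlo : REPred fun q : ι × ℤ × ℕ => (q.2.1 : ℝ) / ((q.2.2 : ℝ) + 1) < t q.1)
    {h : α → ι} {p : α → ℤ} {d a l i : α → ℕ} (hh : Computable h) (hp : Computable p)
    (hd : Computable d) (ha : Computable a) (hl : Computable l) (hi : Computable i) :
    REPred fun x => (p x : ℝ) / ((d x : ℝ) + 1) <
      (a x : ℝ) / 2 ^ l x + t (h x) * ((i x + 1 : ℕ) : ℝ) := by
  refine (hlo.comp (hh.pair (computable_cutCode hp hd ha hl hi))).of_eq fun x => ?_
  rw [cutCode_eq, div_lt_iff₀ (by positivity), sub_lt_iff_lt_add']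

theorem rePred_cell_add_lt
    (hhi : REPred fun q : ι × ℤ × ℕ => t q.1 < (q.2.1 : ℝ) / ((q.2.2 : ℝ) + 1))
    {h : α → ι} {p : α → ℤ} {d a l i : α → ℕ} (hh : Computable h) (hp : Computable p)
    (hd : Computable d) (ha : Computable a) (hl : Computable l) (hi : Computable i) :
    REPred fun x => (a x : ℝ) / 2 ^ l x + t (h x) * ((i x + 1 : ℕ) : ℝ) <
      (p x : ℝ) / ((d x : ℝ) + 1) := by
  refine (hhi.comp (hh.pair (computable_cutCode hp hd ha hl hi))).of_eq fun x => ?_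
  rw [cutCode_eq, lt_div_iff₀ (by positivity), lt_sub_iff_add_lt']

/-- A computable choice of steps: `t (g (l, j))` lies between `z j / 2 ^ l` and
`(z j + 1) / 2 ^ l`. -/
theorem exists_computable_steps
    (hlo : REPred fun q : ι × ℤ × ℕ => (q.2.1 : ℝ) / ((q.2.2 : ℝ) + 1) < t q.1)
    (hhi : REPred fun q : ι × ℤ × ℕ => t q.1 < (q.2.1 : ℝ) / ((q.2.2 : ℝ) + 1))
    (hdense : ∀ u v : ℝ, u < v → ∃ h, t h ∈ Ioo u v) {z : ℕ → ℤ} (hz : Computable z) :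
    ∃ g : ℕ × ℕ → ι, Computable g ∧
      ∀ q, t (g q) ∈ Ioo ((z q.2 : ℝ) / 2 ^ q.1) (((z q.2 : ℝ) + 1) / 2 ^ q.1) := by
  have hzq : Computable fun x : (ℕ × ℕ) × ι => z x.1.2 :=
    hz.comp (Computable.snd.comp Computable.fst)
  have hden : Computable fun x : (ℕ × ℕ) × ι => 2 ^ x.1.1 - 1 :=
    Primrec.nat_sub.to_comp.comp (Primrec.nat_pow.to_comp.comp (Computable.const 2)
      (Computable.fst.comp Computable.fst)) (Computable.const 1)
  have h1 := hlo.comp (Computable.snd.pair (hzq.pair hden))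
  have h2 := hhi.comp (Computable.snd.pair
    ((Primrec.int_add.to_comp.comp hzq (Computable.const 1)).pair hden))
  refine REPred.exists_uniformization (p := fun (q : ℕ × ℕ) (h : ι) =>
    t h ∈ Ioo ((z q.2 : ℝ) / 2 ^ q.1) (((z q.2 : ℝ) + 1) / 2 ^ q.1)) ?_ fun q => ?_
  · refine (h1.and h2).of_eq fun x => ?_
    push_cast [Nat.one_le_two_pow]
    simp
  · refine hdense _ _ ?_
    gcongr
    linarith

end Cuts

section Progression

variable {ι : Type*} {t : ι → ℝ} {W : ℤ × ℤ × ℕ → Prop}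

/-- The statement that the cell `a` of level `l` is seen to consist of points `x` such that, for
all `j < M`, one of the points `x + t (h j) * i` with `1 ≤ i ≤ k` lies in an interval enumerated
by `W`. -/
def ProgressionsMeet (t : ι → ℝ) (W : ℤ × ℤ × ℕ → Prop) (k : ℕ) (h : ℕ → ι) (M l a : ℕ) : Prop :=
  ∀ j < M, ∃ r : ℕ × (ℤ × ℤ × ℕ), r.1 + 1 ≤ k ∧ W r.2 ∧
    (r.2.1 : ℝ) / ((r.2.2.2 : ℝ) + 1) < (a : ℝ) / 2 ^ l + t (h j) * ((r.1 + 1 : ℕ) : ℝ) ∧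
    ((a + 1 : ℕ) : ℝ) / 2 ^ l + t (h j) * ((r.1 + 1 : ℕ) : ℝ) <
      (r.2.2.1 : ℝ) / ((r.2.2.2 : ℝ) + 1)

theorem rePred_progressionsMeet [Primcodable ι] (hW : REPred W)
    (hlo : REPred fun q : ι × ℤ × ℕ => (q.2.1 : ℝ) / ((q.2.2 : ℝ) + 1) < t q.1)
    (hhi : REPred fun q : ι × ℤ × ℕ => t q.1 < (q.2.1 : ℝ) / ((q.2.2 : ℝ) + 1))
    {g : ℕ × ℕ → ι} (hg : Computable g) (k : ℕ) {M : ℕ → ℕ} (hM : Computable M) :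
    REPred fun q : ℕ × ℕ × ℕ =>
      ProgressionsMeet t W k (fun j => g (q.1, j)) (M q.1) q.2.1 q.2.2 := by
  refine REPred.forall_lt (REPred.exists_right ?_) (hM.comp Computable.fst)
  let Γ := ((ℕ × ℕ × ℕ) × ℕ) × (ℕ × (ℤ × ℤ × ℕ))
  have hq : Computable fun x : Γ => x.1.1 := Computable.fst.comp Computable.fst
  have hi : Computable fun x : Γ => x.2.1 := Computable.fst.comp Computable.snd
  have hc : Computable fun x : Γ => x.2.2 := Computable.snd.comp Computable.snd
  have hc2 : Computable fun x : Γ => x.2.2.2 := Computable.snd.comp hc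
  have hd : Computable fun x : Γ => x.2.2.2.2 := Computable.snd.comp hc2
  have hh : Computable fun x : Γ => g (x.1.1.1, x.1.2) :=
    hg.comp ((Computable.fst.comp hq).pair (Computable.snd.comp Computable.fst))
  have hl : Computable fun x : Γ => x.1.1.2.1 := Computable.fst.comp (Computable.snd.comp hq)
  have ha : Computable fun x : Γ => x.1.1.2.2 := Computable.snd.comp (Computable.snd.comp hq)
  exact (REPred.nat_le_of_computable (Computable.succ.comp hi) (Computable.const k)).and
    ((hW.comp hc).and
      ((rePred_lt_cell_add hlo hh (Computable.fst.comp hc) hd ha hl hi).and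
        (rePred_cell_add_lt hhi hh (Computable.fst.comp hc2) hd (Computable.succ.comp ha) hl hi)))

theorem progressionsMeet_of_exists {k M : ℕ} {h : ℕ → ι} {x : ℝ} (hx : 0 ≤ x)
    (hB : ∀ j < M, ∃ i < k, x + t (h j) * ((i + 1 : ℕ) : ℝ) ∈
      ⋃ c, ⋃ (_ : W c), ratInterval c) :
    ∃ l, ProgressionsMeet t W k h M l (cellIndex l x) := by
  have key : ∀ᶠ l in Filter.atTop, ∀ j ∈ Finset.range M, ∃ r : ℕ × (ℤ × ℤ × ℕ), r.1 + 1 ≤ k ∧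
      W r.2 ∧ (r.2.1 : ℝ) / ((r.2.2.2 : ℝ) + 1) <
        (cellIndex l x : ℝ) / 2 ^ l + t (h j) * ((r.1 + 1 : ℕ) : ℝ) ∧
      ((cellIndex l x + 1 : ℕ) : ℝ) / 2 ^ l + t (h j) * ((r.1 + 1 : ℕ) : ℝ) <
        (r.2.2.1 : ℝ) / ((r.2.2.2 : ℝ) + 1) := by
    rw [Filter.eventually_all_finset]
    intro j hj
    obtain ⟨i, hi, hiB⟩ := hB j (Finset.mem_range.1 hj)
    simp only [mem_iUnion] at hiB
    obtain ⟨c, hc, hxc⟩ := hiB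
    filter_upwards [eventually_cell_subset hx hxc] with l hl
    exact ⟨(i, c), hi, hc, hl.1, by push_cast at hl ⊢; exact hl.2⟩
  obtain ⟨l, hl⟩ := key.exists
  exact ⟨l, fun j hj => hl j (Finset.mem_range.2 hj)⟩

theorem exists_of_progressionsMeet {k M l : ℕ} {h : ℕ → ι} {x : ℝ} (hx : 0 ≤ x)
    (hl : ProgressionsMeet t W k h M l (cellIndex l x)) :
    ∀ j < M, ∃ i < k, x + t (h j) * ((i + 1 : ℕ) : ℝ) ∈ ⋃ c, ⋃ (_ : W c), ratInterval c := by
  intro j hj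
  obtain ⟨⟨i, c⟩, hi, hc, h1, h2⟩ := hl j hj
  refine ⟨i, hi, mem_iUnion₂.2 ⟨c, hc, ?_⟩⟩
  obtain ⟨h3, h4⟩ := mem_dyadicCell_cellIndex (n := l) hx
  push_cast at h2
  exact ⟨h1.trans_le (by simpa using h3), lt_trans (by simpa using h4) h2⟩

/-- A random real inside a region `J` in which the union `B` of the intervals enumerated by `W`
has small measure starts a progression of length `k` that avoids `B`. Inside a cell of level `b`
one uses `2 ^ (b - e)` steps, one from each of the slots `(z j / 2 ^ b, (z j + 1) / 2 ^ b)`; at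
most half of the cell consists of points whose progressions all meet `B`. -/
theorem IsMartinLofRandom.exists_progression_of_small_measure [Primcodable ι] {X : ℝ}
    (hX : IsMartinLofRandom X) (hW : REPred W)
    (hlo : REPred fun q : ι × ℤ × ℕ => (q.2.1 : ℝ) / ((q.2.2 : ℝ) + 1) < t q.1)
    (hhi : REPred fun q : ι × ℤ × ℕ => t q.1 < (q.2.1 : ℝ) / ((q.2.2 : ℝ) + 1))
    (hdense : ∀ u v : ℝ, u < v → ∃ h, t h ∈ Ioo u v) {z : ℕ → ℤ} (hz : Computable z)
    (hsep : ∀ j j', j ≠ j' → 2 ≤ |z j - z j'|) {J : Set ℝ} (k e : ℕ)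
    (hJ : ∀ b ≥ e, ∀ j < 2 ^ (b - e), ∀ s ∈ Ioo ((z j : ℝ) / 2 ^ b) (((z j : ℝ) + 1) / 2 ^ b),
      ∀ x, 0 ≤ x → cellIndex e x = cellIndex e X → ∀ i ≤ k, x + s * (i : ℝ) ∈ J)
    (hvol : k * volume ((⋃ c, ⋃ (_ : W c), ratInterval c) ∩ J) ≤ (2 : ℝ≥0∞)⁻¹ ^ (e + 1)) :
    ∃ b ≥ e, ∃ j < 2 ^ (b - e), ∃ h, t h ∈ Ioo ((z j : ℝ) / 2 ^ b) (((z j : ℝ) + 1) / 2 ^ b) ∧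
      ∀ i < k, X + t h * ((i + 1 : ℕ) : ℝ) ∉ ⋃ c, ⋃ (_ : W c), ratInterval c := by
  set B := ⋃ c, ⋃ (_ : W c), ratInterval c with hBdef
  have hB : MeasurableSet B :=
    (isOpen_iUnion fun c => isOpen_iUnion fun _ => isOpen_Ioo).measurableSet
  obtain ⟨g, hg, hgt⟩ := exists_computable_steps hlo hhi hdense hz
  have hM : Computable fun b : ℕ => 2 ^ (b - e) :=
    (Primrec.nat_pow.comp (Primrec.const 2)
      (Primrec.nat_sub.comp Primrec.id (Primrec.const e))).to_comp
  have hE := rePred_progressionsMeet hW hlo hhi hg k hM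
  obtain ⟨b, hb, h⟩ := hX.exists_not_enumerated (E := fun b l a =>
    ProgressionsMeet t W k (fun j => g (b, j)) (2 ^ (b - e)) l a) hE (c := 2⁻¹) (by simp) e
    fun b hb a ha => by
      have hcell : ∀ x ∈ dyadicCell b a, cellIndex e x = cellIndex e X := by
        intro x hx
        rw [← ha, ← cellIndex_of_mem hx, cellIndex_div hb]
      have key := card_mul_volume_progression_le (J := J) hB ((a : ℝ) / 2 ^ b)
        (((a : ℝ) + 1) / 2 ^ b) (fun j => t (g (b, j))) (2 ^ (b - e)) k ?_ ?_
      · have hMne : ((2 ^ (b - e) : ℕ) : ℝ≥0∞) ≠ 0 := by positivity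
        refine (ENNReal.mul_le_mul_iff_right hMne (ENNReal.natCast_ne_top _)).1 ?_
        calc ((2 ^ (b - e) : ℕ) : ℝ≥0∞) * _
            ≤ k * volume (B ∩ J) := by
              refine le_trans (mul_le_mul_right (measure_mono ?_) _) key
              rintro x ⟨hx, l, hl⟩
              exact ⟨hx, exists_of_progressionsMeet (nonneg_of_mem_dyadicCell hx) hl⟩
          _ ≤ (2 : ℝ≥0∞)⁻¹ ^ (e + 1) := hvol
          _ = ((2 ^ (b - e) : ℕ) : ℝ≥0∞) * (2⁻¹ * (2 : ℝ≥0∞)⁻¹ ^ b) := by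
              rw [pow_succ', inv_two_pow_eq_mul hb, mul_left_comm]
      · -- distinct slots have distance at least the length of a cell
        intro j _ j' _ hne
        have h2 := hsep j j' hne
        obtain ⟨l1, u1⟩ := hgt (b, j)
        obtain ⟨l2, u2⟩ := hgt (b, j')
        have hpos : (0 : ℝ) < 2 ^ b := by positivity
        rw [← sub_div, add_sub_cancel_left, div_le_iff₀ hpos]
        rw [div_lt_iff₀ hpos] at l1 l2
        rw [lt_div_iff₀ hpos] at u1 u2
        dsimp only at l1 l2 u1 u2
        rw [← abs_of_pos hpos, ← abs_mul, sub_mul, le_abs]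
        rcases le_abs.1 h2 with h3 | h3
        · left
          have : (2 : ℝ) ≤ (z j : ℝ) - z j' := by exact_mod_cast h3
          linarith
        · right
          have : (2 : ℝ) ≤ -((z j : ℝ) - z j') := by exact_mod_cast h3
          linarith
      · intro j hj i hi x hx
        exact hJ b hb j hj _ (hgt (b, j)) x (nonneg_of_mem_dyadicCell hx) (hcell x hx) (i + 1) hi
  by_contra! hcon
  obtain ⟨l, hl⟩ := progressionsMeet_of_exists (t := t) (W := W) (k := k) (M := 2 ^ (b - e))
    (h := fun j => g (b, j)) hX.1.1 fun j hj => by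
      obtain ⟨i, hi, hiB⟩ := hcon b hb j hj (g (b, j)) (hgt (b, j))
      exact ⟨i, hi, hiB⟩
  exact h l hl

end Progression

/-- The density statement for the union of the intervals enumerated by `W`. -/
theorem IsMartinLofRandom.exists_cell_small_measure {X : ℝ} (hX : IsMartinLofRandom X)
    {W : ℤ × ℤ × ℕ → Prop} (hW : REPred W) (hXW : X ∉ ⋃ c, ⋃ (_ : W c), ratInterval c)
    {K : ℕ} (hK : 0 < K) :
    ∃ b, volume ((⋃ c, ⋃ (_ : W c), ratInterval c) ∩ dyadicCell b (cellIndex b X)) ≤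
      (2 : ℝ≥0∞)⁻¹ ^ b / K := by
  -- the progressions of length one with step `0` enumerate the cells inside the given open set
  let t : Unit → ℝ := fun _ => 0
  have hlo : REPred fun q : Unit × ℤ × ℕ => (q.2.1 : ℝ) / ((q.2.2 : ℝ) + 1) < t q.1 := by
    refine (REPred.int_lt_of_computable (Computable.fst.comp Computable.snd)
      (Computable.const 0)).of_eq fun q => ?_
    rw [div_lt_iff₀ (by positivity), zero_mul]
    exact_mod_cast Iff.rfl
  have hhi : REPred fun q : Unit × ℤ × ℕ => t q.1 < (q.2.1 : ℝ) / ((q.2.2 : ℝ) + 1) := by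
    refine (REPred.int_lt_of_computable (Computable.const 0)
      (Computable.fst.comp Computable.snd)).of_eq fun q => ?_
    rw [lt_div_iff₀ (by positivity), zero_mul]
    exact_mod_cast Iff.rfl
  have hE : REPred fun p : ℕ × ℕ => ProgressionsMeet t W 1 (fun _ => ()) 1 p.1 p.2 := by
    have h : REPred fun q : ℕ × ℕ × ℕ => ProgressionsMeet t W 1 (fun _ => ()) 1 q.2.1 q.2.2 :=
      rePred_progressionsMeet (g := fun _ => ()) (M := fun _ => 1) hW hlo hhi
        (Computable.const ()) 1 (Computable.const 1)
    have hg : Computable fun p : ℕ × ℕ => ((0, p) : ℕ × ℕ × ℕ) :=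
      (Computable.const 0).pair Computable.id
    exact (h.comp hg).of_eq fun _ => Iff.rfl
  have hiff : ∀ x, 0 ≤ x → ((∃ l, ProgressionsMeet t W 1 (fun _ => ()) 1 l (cellIndex l x)) ↔
      x ∈ ⋃ c, ⋃ (_ : W c), ratInterval c) := by
    intro x hx
    constructor
    · rintro ⟨l, hl⟩
      obtain ⟨i, -, h⟩ := exists_of_progressionsMeet hx hl 0 one_pos
      rwa [zero_mul, add_zero] at h
    · intro h
      exact progressionsMeet_of_exists hx fun j _ => ⟨0, one_pos, by rwa [zero_mul, add_zero]⟩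
  obtain ⟨b, hb⟩ := hX.exists_small_density hE
    (fun l hl => hXW ((hiff X hX.1.1).1 ⟨l, hl⟩)) hK
  refine ⟨b, le_trans (measure_mono ?_) hb⟩
  rintro x ⟨hxB, hx⟩
  exact ⟨hx, (hiff x (nonneg_of_mem_dyadicCell hx)).2 hxB⟩

/-! ### Recurrence -/

/-- Recurrence along progressions: a random real in a `Π⁰₁` class starts a progression that stays
in the class, with a step taken from any given dense, effectively presented family of reals. -/
theorem IsMartinLofRandom.exists_progression {X : ℝ} (hX : IsMartinLofRandom X) {P : Set ℝ}
    (hP : IsPi01Class P) (hXP : X ∈ P) {ι : Type*} [Primcodable ι] {t : ι → ℝ}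
    (hlo : REPred fun q : ι × ℤ × ℕ => (q.2.1 : ℝ) / ((q.2.2 : ℝ) + 1) < t q.1)
    (hhi : REPred fun q : ι × ℤ × ℕ => t q.1 < (q.2.1 : ℝ) / ((q.2.2 : ℝ) + 1))
    (hdense : ∀ u v : ℝ, u < v → ∃ h, t h ∈ Ioo u v) (k : ℕ) :
    ∃ h, t h ≠ 0 ∧ |t h| < 1 ∧ ∀ i ≤ k, X + t h * (i : ℝ) ∈ P ∩ Iio 1 := by
  obtain ⟨hP01, W, hW, hPW⟩ := hP
  set B := ⋃ c, ⋃ (_ : W c), ratInterval c with hBdef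
  have hmemP : ∀ y ∈ Icc (0 : ℝ) 1, y ∉ B → y ∈ P := by
    intro y hy hyB
    by_contra hyP
    have : y ∈ Icc 0 1 ∩ B := hPW ▸ ⟨hy, hyP⟩
    exact hyB this.2
  have hXB : X ∉ B := fun h => by
    have : X ∈ Icc 0 1 \ P := hPW ▸ ⟨hX.1, h⟩
    exact this.2 hXP
  have hX1 := hX.lt_one
  obtain ⟨b₁, hb₁⟩ := hX.exists_cell_small_measure hW hXB
    (K := (k + 1) * 2 ^ (k + 3)) (by positivity)
  set a₁ := cellIndex b₁ X with ha₁
  -- steps are at most `2 / 2 ^ e` long, so that `k` of them cover at most half of the cell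
  set e := b₁ + (k + 2) with he
  have hvol : k * volume (B ∩ dyadicCell b₁ a₁) ≤ (2 : ℝ≥0∞)⁻¹ ^ (e + 1) := by
    calc k * volume (B ∩ dyadicCell b₁ a₁)
        ≤ k * ((2 : ℝ≥0∞)⁻¹ ^ b₁ / ((k + 1) * 2 ^ (k + 3) : ℕ)) := by gcongr
      _ ≤ (2 : ℝ≥0∞)⁻¹ ^ (e + 1) := by
        rw [← mul_div_assoc]
        refine ENNReal.div_le_of_le_mul ?_
        rw [inv_two_pow_eq_mul (show b₁ ≤ e + 1 by omega), show e + 1 - b₁ = k + 3 by omega,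
          mul_comm _ (((k + 1) * 2 ^ (k + 3) : ℕ) : ℝ≥0∞), ← mul_assoc]
        gcongr
        exact_mod_cast Nat.mul_le_mul_right _ (Nat.le_succ k)
  have hJ1 : ∀ y ∈ dyadicCell b₁ a₁, 0 ≤ y ∧ y < 1 := by
    intro y hy
    refine ⟨nonneg_of_mem_dyadicCell hy, hy.2.trans_le ?_⟩
    have h1 : a₁ < 2 ^ b₁ := by
      rw [ha₁, cellIndex, Nat.floor_lt (by have := hX.1.1; positivity)]
      push_cast
      exact mul_lt_of_lt_one_left (by positivity) hX1
    rw [div_le_one (by positivity)]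
    exact_mod_cast h1
  have hsmall : ∀ s : ℝ, |s| ≤ 2 / 2 ^ e → ∀ i ≤ k, |s * (i : ℝ)| ≤ 1 / 2 ^ (b₁ + 1) := by
    intro s hs i hi
    rw [abs_mul, Nat.abs_cast]
    have h1 : (i : ℝ) ≤ 2 ^ k := by exact_mod_cast hi.trans Nat.lt_two_pow_self.le
    calc |s| * (i : ℝ) ≤ 2 / 2 ^ e * 2 ^ k := by gcongr
      _ = 1 / 2 ^ (b₁ + 1) := by
        rw [he, pow_add, pow_add, pow_add]
        field_simp
  -- a choice of slots for the steps, all on the side of `0` on which `X` has room inside the cell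
  obtain ⟨z, hz, hsep, hslot⟩ : ∃ z : ℕ → ℤ, Computable z ∧ (∀ j j', j ≠ j' → 2 ≤ |z j - z j'|) ∧
      ∀ b ≥ e, ∀ j < 2 ^ (b - e), ∀ s ∈ Ioo ((z j : ℝ) / 2 ^ b) (((z j : ℝ) + 1) / 2 ^ b),
        s ≠ 0 ∧ |s| ≤ 2 / 2 ^ e ∧ ∀ x, 0 ≤ x → cellIndex e x = cellIndex e X → ∀ i ≤ k,
          x + s * (i : ℝ) ∈ dyadicCell b₁ a₁ := by
    have hhalf : ∀ x, cellIndex e x = cellIndex e X →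
        cellIndex (b₁ + 1) x = cellIndex (b₁ + 1) X := by
      intro x hx
      have hle : b₁ + 1 ≤ e := by omega
      rw [← cellIndex_div hle x, hx, cellIndex_div hle]
    have hbound : ∀ b ≥ e, ∀ j : ℕ, j < 2 ^ (b - e) → (2 * (j : ℝ) + 1) / 2 ^ b ≤ 2 / 2 ^ e := by
      intro b hb j hj
      have h1 : (j : ℝ) + 1 ≤ 2 ^ (b - e) := by exact_mod_cast hj
      rw [div_le_div_iff₀ (by positivity) (by positivity)]
      calc (2 * (j : ℝ) + 1) * 2 ^ e ≤ (2 * 2 ^ (b - e)) * 2 ^ e := by gcongr; linarith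
        _ = 2 * 2 ^ b := by rw [mul_assoc, ← pow_add, Nat.sub_add_cancel hb]
    have hdiv : cellIndex (b₁ + 1) X / 2 = a₁ := by
      have := cellIndex_div (Nat.le_succ b₁) X
      simpa using this
    have hpow : (2 : ℝ) ^ (b₁ + 1) = 2 * 2 ^ b₁ := pow_succ' 2 b₁
    have hpos : (0 : ℝ) < 2 ^ b₁ := by positivity
    rcases Nat.even_or_odd' (cellIndex (b₁ + 1) X) with ⟨c, hc | hc⟩
    · have hca : c = a₁ := by omega
      refine ⟨fun j => 2 * (j : ℤ), ?_, fun j j' hne => ?_, fun b hb j hj s hs => ?_⟩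
      · exact (Primrec.int_mul.comp (Primrec.const 2) Primrec.int_natCast).to_comp
      · have : (j : ℤ) ≠ j' := by exact_mod_cast hne
        dsimp only
        rw [le_abs]
        omega
      · push_cast at hs
        have hs0 : 0 < s := lt_of_le_of_lt (by positivity) hs.1
        have hs1 : |s| ≤ 2 / 2 ^ e := by
          rw [abs_of_pos hs0]
          exact hs.2.le.trans (hbound b hb j hj)
        refine ⟨hs0.ne', hs1, fun x hx hxe i hi => ?_⟩
        have h1 := (abs_le.1 (hsmall s hs1 i hi)).2
        have h0 : 0 ≤ s * (i : ℝ) := by positivity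
        obtain ⟨h2, h3⟩ := (cellIndex_eq_iff hx).1 ((hhalf x hxe).trans (hc.trans (by rw [hca])))
        push_cast at h2 h3
        rw [hpow] at h1 h2 h3
        have e1 : (2 * (a₁ : ℝ)) / (2 * 2 ^ b₁) = a₁ / 2 ^ b₁ := by field_simp
        have e2 : (2 * (a₁ : ℝ) + 1) / (2 * 2 ^ b₁) + 1 / (2 * 2 ^ b₁) = (a₁ + 1) / 2 ^ b₁ := by
          field_simp; ring
        exact ⟨by linarith, by linarith⟩
    · have hca : c = a₁ := by omega
      refine ⟨fun j => -(2 * (j : ℤ) + 1), ?_, fun j j' hne => ?_, fun b hb j hj s hs => ?_⟩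
      · exact (Primrec.int_neg.comp (Primrec.int_add.comp (Primrec.int_mul.comp (Primrec.const 2)
          Primrec.int_natCast) (Primrec.const 1))).to_comp
      · have : (j : ℤ) ≠ j' := by exact_mod_cast hne
        dsimp only
        rw [le_abs]
        omega
      · push_cast at hs
        have hs0 : s < 0 := by
          refine lt_of_lt_of_le hs.2 (div_nonpos_of_nonpos_of_nonneg ?_ (by positivity))
          have : (0 : ℝ) ≤ j := by positivity
          linarith
        have hs1 : |s| ≤ 2 / 2 ^ e := by
          rw [abs_of_neg hs0]
          refine le_trans ?_ (hbound b hb j hj)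
          have := hs.1
          rw [neg_div] at this
          linarith
        refine ⟨hs0.ne, hs1, fun x hx hxe i hi => ?_⟩
        have h1 := (abs_le.1 (hsmall s hs1 i hi)).1
        have h0 : s * (i : ℝ) ≤ 0 := mul_nonpos_of_nonpos_of_nonneg hs0.le (by positivity)
        obtain ⟨h2, h3⟩ := (cellIndex_eq_iff hx).1 ((hhalf x hxe).trans (hc.trans (by rw [hca])))
        push_cast at h2 h3
        rw [hpow] at h1 h2 h3
        have e1 : (2 * (a₁ : ℝ) + 1) / (2 * 2 ^ b₁) - 1 / (2 * 2 ^ b₁) = a₁ / 2 ^ b₁ := by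
          field_simp; ring
        have e2 : (2 * (a₁ : ℝ) + 1 + 1) / (2 * 2 ^ b₁) = (a₁ + 1) / 2 ^ b₁ := by
          field_simp; ring
        exact ⟨by linarith, by linarith⟩
  obtain ⟨b, hb, j, hj, h, hth, hprog⟩ := hX.exists_progression_of_small_measure hW hlo hhi hdense
    hz hsep k e (fun b hb j hj s hs => (hslot b hb j hj s hs).2.2) hvol
  obtain ⟨hne, hsm, hin⟩ := hslot b hb j hj _ hth
  refine ⟨h, hne, hsm.trans_lt ?_, fun i hi => ?_⟩
  · rw [div_lt_one (by positivity)]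
    calc (2 : ℝ) < 2 ^ 2 := by norm_num
      _ ≤ 2 ^ e := pow_le_pow_right₀ (by norm_num) (by omega)
  · obtain ⟨h0, h1⟩ := hJ1 _ (hin X hX.1.1 rfl i hi)
    refine ⟨?_, h1⟩
    rcases i with _ | i
    · simpa using hXP
    · exact hmemP _ ⟨h0, h1.le⟩ (hprog i hi)

/-! ### Two families of steps -/

theorem rePred_rat_lo : REPred fun q : (ℤ × ℕ) × ℤ × ℕ =>
    (q.2.1 : ℝ) / ((q.2.2 : ℝ) + 1) < (q.1.1 : ℝ) / ((q.1.2 : ℝ) + 1) := by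
  have hs : Primrec fun n : ℕ => ((n + 1 : ℕ) : ℤ) := Primrec.int_natCast.comp Primrec.succ
  refine (REPred.int_lt_of_computable
    (f := fun q : (ℤ × ℕ) × ℤ × ℕ => q.2.1 * ((q.1.2 + 1 : ℕ) : ℤ))
    (g := fun q : (ℤ × ℕ) × ℤ × ℕ => q.1.1 * ((q.2.2 + 1 : ℕ) : ℤ)) ?_ ?_).of_eq fun q => ?_
  · exact (Primrec.int_mul.comp (Primrec.fst.comp Primrec.snd)
      (hs.comp (Primrec.snd.comp Primrec.fst))).to_comp
  · exact (Primrec.int_mul.comp (Primrec.fst.comp Primrec.fst)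
      (hs.comp (Primrec.snd.comp Primrec.snd))).to_comp
  · rw [div_lt_div_iff₀ (by positivity) (by positivity)]
    exact_mod_cast Iff.rfl

theorem rePred_rat_hi : REPred fun q : (ℤ × ℕ) × ℤ × ℕ =>
    (q.1.1 : ℝ) / ((q.1.2 : ℝ) + 1) < (q.2.1 : ℝ) / ((q.2.2 : ℝ) + 1) :=
  have hswap : Computable fun q : (ℤ × ℕ) × ℤ × ℕ => (q.2, q.1) :=
    Computable.snd.pair Computable.fst
  (rePred_rat_lo.comp hswap).of_eq fun _ => Iff.rfl

/-- The lower cuts of `u * α + v` are recursively enumerable, because an approximation of `α` up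
to `1 / 2 ^ N` approximates `u * α + v` up to `|u| / 2 ^ N`. -/
theorem rePred_linear_lo {α : ℝ} (hα : IsComputableReal α) : REPred fun q : (ℤ × ℤ) × ℤ × ℕ =>
    (q.2.1 : ℝ) / ((q.2.2 : ℝ) + 1) < (q.1.1 : ℝ) * α + (q.1.2 : ℝ) := by
  obtain ⟨f, hf, hfα⟩ := hα
  have h1 : REPred fun x : ((ℤ × ℤ) × ℤ × ℕ) × ℕ => x.1.2.1 * ((2 ^ x.2 : ℕ) : ℤ) <
      (x.1.1.1 * f x.2 + x.1.1.2 * ((2 ^ x.2 : ℕ) : ℤ) - (x.1.1.1.natAbs : ℤ)) *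
        ((x.1.2.2 + 1 : ℕ) : ℤ) := by
    let Γ := ((ℤ × ℤ) × ℤ × ℕ) × ℕ
    have hpow : Computable fun x : Γ => ((2 ^ x.2 : ℕ) : ℤ) :=
      (Primrec.int_natCast.comp (Primrec.nat_pow.comp (Primrec.const 2) Primrec.snd)).to_comp
    have hu : Computable fun x : Γ => x.1.1.1 :=
      Computable.fst.comp (Computable.fst.comp Computable.fst)
    have hv : Computable fun x : Γ => x.1.1.2 :=
      Computable.snd.comp (Computable.fst.comp Computable.fst)
    have hp : Computable fun x : Γ => x.1.2.1 :=
      Computable.fst.comp (Computable.snd.comp Computable.fst)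
    have hq : Computable fun x : Γ => ((x.1.2.2 + 1 : ℕ) : ℤ) :=
      (Primrec.int_natCast.comp Primrec.succ).to_comp.comp
        (Computable.snd.comp (Computable.snd.comp Computable.fst))
    refine REPred.int_lt_of_computable (Primrec.int_mul.to_comp.comp hp hpow)
      (Primrec.int_mul.to_comp.comp (Primrec.int_sub.to_comp.comp (Primrec.int_add.to_comp.comp
        (Primrec.int_mul.to_comp.comp hu (hf.comp Computable.snd))
        (Primrec.int_mul.to_comp.comp hv hpow))
        ((Primrec.int_natCast.comp Primrec.int_natAbs).to_comp.comp hu)) hq)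
  refine (REPred.exists_right (p := fun (q : (ℤ × ℤ) × ℤ × ℕ) (N : ℕ) =>
    q.2.1 * ((2 ^ N : ℕ) : ℤ) < (q.1.1 * f N + q.1.2 * ((2 ^ N : ℕ) : ℤ) - (q.1.1.natAbs : ℤ)) *
      ((q.2.2 + 1 : ℕ) : ℤ)) h1).of_eq ?_
  rintro ⟨⟨u, v⟩, p, q⟩
  dsimp only
  have hcast : ∀ N : ℕ, (p * ((2 ^ N : ℕ) : ℤ) <
      (u * f N + v * ((2 ^ N : ℕ) : ℤ) - (u.natAbs : ℤ)) * ((q + 1 : ℕ) : ℤ)) ↔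
      (p : ℝ) / ((q : ℝ) + 1) < u * ((f N : ℝ) / 2 ^ N) + v - |(u : ℝ)| / 2 ^ N := by
    intro N
    have e1 : (u : ℝ) * ((f N : ℝ) / 2 ^ N) + v - |(u : ℝ)| / 2 ^ N =
        (u * f N + v * 2 ^ N - |(u : ℝ)|) / 2 ^ N := by field_simp
    rw [e1, div_lt_div_iff₀ (by positivity) (by positivity), Int.natCast_natAbs]
    exact_mod_cast Iff.rfl
  have herr : ∀ N : ℕ, |(u : ℝ) * α - u * ((f N : ℝ) / 2 ^ N)| ≤ |(u : ℝ)| / 2 ^ N := by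
    intro N
    rw [← mul_sub, abs_mul, div_eq_mul_one_div |(u : ℝ)|]
    gcongr
    exact hfα N
  simp only [hcast]
  constructor
  · rintro ⟨N, hN⟩
    have := (abs_le.1 (herr N)).1
    linarith
  · intro h
    have hlim : Filter.Tendsto (fun N : ℕ => 2 * |(u : ℝ)| * (1 / 2 : ℝ) ^ N) Filter.atTop
        (nhds 0) := by
      simpa using (tendsto_pow_atTop_nhds_zero_of_lt_one (r := (1 / 2 : ℝ)) (by norm_num)
        (by norm_num)).const_mul (2 * |(u : ℝ)|)
    obtain ⟨N, hN⟩ := (hlim.eventually (gt_mem_nhds (sub_pos.2 h))).exists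
    refine ⟨N, ?_⟩
    have h2 := (abs_le.1 (herr N)).2
    have h3 : 2 * |(u : ℝ)| * (1 / 2 : ℝ) ^ N = 2 * (|(u : ℝ)| / 2 ^ N) := by
      rw [one_div_pow]; ring
    rw [h3] at hN
    linarith

theorem rePred_linear_hi {α : ℝ} (hα : IsComputableReal α) : REPred fun q : (ℤ × ℤ) × ℤ × ℕ =>
    (q.1.1 : ℝ) * α + (q.1.2 : ℝ) < (q.2.1 : ℝ) / ((q.2.2 : ℝ) + 1) := by
  have hneg := Primrec.int_neg.to_comp
  refine ((rePred_linear_lo hα).comp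
    (((hneg.comp (Computable.fst.comp Computable.fst)).pair
      (hneg.comp (Computable.snd.comp Computable.fst))).pair
      ((hneg.comp (Computable.fst.comp Computable.snd)).pair
        (Computable.snd.comp Computable.snd)))).of_eq fun q => ?_
  push_cast
  rw [neg_div, neg_mul, ← neg_add, neg_lt_neg_iff]

theorem Irrational.exists_linear_mem_Ioo {α : ℝ} (hα : Irrational α) {u v : ℝ} (huv : u < v) :
    ∃ p : ℤ × ℤ, (p.1 : ℝ) * α + (p.2 : ℝ) ∈ Ioo u v := by
  have hd : Dense (AddSubgroup.closure {α, 1} : Set ℝ) :=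
    dense_addSubgroupClosure_pair_iff.2 (by simpa using hα)
  obtain ⟨y, hy, hyuv⟩ := hd.exists_mem_open isOpen_Ioo (nonempty_Ioo.2 huv)
  obtain ⟨m, n, rfl⟩ := AddSubgroup.mem_closure_pair.1 hy
  exact ⟨(m, n), by simpa using hyuv⟩

theorem mainTheorem1 (P : Set ℝ) (hP : IsPi01Class P) (X : ℝ) (hX : IsMartinLofRandom X)
    (hXP : X ∈ P) (k : ℕ) :
    (∃ q : ℚ, q ≠ 0 ∧ ∀ i : ℕ, i ≤ k → X + (q : ℝ) * (i : ℝ) ∈ P) ∧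
    (∀ α : ℝ, IsComputableReal α → Irrational α →
      ∃ n : ℤ, n ≠ 0 ∧ ∀ i : ℕ, i ≤ k → Int.fract (X + α * (n : ℝ) * (i : ℝ)) ∈ P) := by
  constructor
  · obtain ⟨⟨v, w⟩, hne, -, h⟩ := hX.exists_progression hP hXP
      (t := fun h : ℤ × ℕ => (h.1 : ℝ) / ((h.2 : ℝ) + 1)) rePred_rat_lo rePred_rat_hi
      (fun a b hab => by
        obtain ⟨q, hq⟩ := exists_rat_btwn hab
        refine ⟨(q.num, q.den - 1), ?_⟩
        have : ((q.den - 1 : ℕ) : ℝ) + 1 = q.den := by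
          exact_mod_cast Nat.sub_add_cancel q.pos
        rw [this, ← Rat.cast_def]
        exact hq) k
    refine ⟨(v : ℚ) / ((w : ℚ) + 1), ?_, fun i hi => ?_⟩
    · intro h0
      refine hne ?_
      have := congrArg (fun q : ℚ => (q : ℝ)) h0
      push_cast at this
      exact this
    · push_cast
      exact (h i hi).1
  · intro α hαc hαi
    obtain ⟨⟨u, v⟩, hne, hlt, h⟩ := hX.exists_progression hP hXP
      (t := fun h : ℤ × ℤ => (h.1 : ℝ) * α + (h.2 : ℝ)) (rePred_linear_lo hαc)
      (rePred_linear_hi hαc) (fun a b hab => hαi.exists_linear_mem_Ioo hab) k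
    dsimp only at hne hlt h
    refine ⟨u, ?_, fun i hi => ?_⟩
    · -- otherwise the step would be a nonzero integer of absolute value less than `1`
      rintro rfl
      rw [Int.cast_zero, zero_mul, zero_add] at hne hlt
      exact hne (by exact_mod_cast Int.abs_lt_one_iff.1 (by exact_mod_cast hlt))
    · obtain ⟨hiP, hi1⟩ := h i hi
      have hfr : Int.fract (X + α * (u : ℝ) * (i : ℝ)) = X + ((u : ℝ) * α + v) * (i : ℝ) := by
        have : X + α * (u : ℝ) * (i : ℝ) =
            X + ((u : ℝ) * α + v) * (i : ℝ) - ((v * i : ℤ) : ℝ) := by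
          push_cast; ring
        rw [this, Int.fract_sub_intCast, Int.fract_eq_self]
        exact ⟨(hP.1 hiP).1, hi1⟩
      rwa [hfr]
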